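/- **Setting.** Let $N=MB$ with $B\ge 1$, $0\le R\le M-2$, and let $p_1,\dots,p_N>0$ with $\sum_i p_i=1$. In each round $t=0,1,\dots$ an ordered batch $X_t$ of $B$ distinct clients is sampled; $S_t$ is its set of clients. The first $R$ batches are pairwise disjoint, with an arbitrary joint law. For $t\ge R$, conditionally on the past, $X_t=J$ with probability $p_J/\sum_{J'}p_{J'}$ if $J$ is disjoint from $X_{t-1},\dots,X_{t-R}$ and with probability $0$ otherwise, where $p_J=\sum_{i\in J}p_i$ and $J'$ runs over all ordered batches disjoint from $X_{t-1},\dots,X_{t-R}$. The windows $(X_t,\dots,X_{t-R+1})$ form a Markov chain on the $R$-tuples of pairwise disjoint ordered batches (for $R=0$, on one point), with transition matrix $P_R$. It has a unique stationary distribution $\zeta_R$, and $P_R^t(y,y')\to\zeta_R(y')$ for all $y,y'$. Let $\pi_R\in\mathbb R^N$ be the law of the first client of the batch sampled next when the window has law $\zeta_R$, and let $\tau_{mix}=\inf\{l\ge1:\max_y\|P_R^l(y,\cdot)-\zeta_R\|_{TV}\le 1/4\}$. Let $f_1,\dots,f_N:\mathbb R^d\to\mathbb R$ be differentiable and $F=\frac1N\sum_i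 f_i$. FedAvg with $K\ge1$ local steps, stepsize $\alpha$ and starting point $x_0$ is $x_{t+1}=\frac1B\sum_{i\in S_t}x^i_{t,K}$, where $x^i_{t,0}=x_t$ and $x^i_{t,k+1}=x^i_{t,k}-\alpha\nabla f_i(x^i_{t,k})$. The output $\tilde x_T$ is drawn uniformly from $x_0,\dots,x_{T-1}$, independently of the sampling. **Theorem (bound).** There is an absolute constant $C_b$, and for all $L,G,D>0$, $\Delta\ge0$ and $0<c_1\le c_2$ there is a constant $C$, depending on these six numbers only, such that the following holds in every such setting. Suppose that each $\nabla f_i$ is $L$-Lipschitz and that $\|\nabla f_i(x)-\nabla F(x)\|^2\le G^2$ and $\|\nabla F(x)\|\le D$ for all $x$ and $i$, and that $F(x_0)-\inf F\le\Delta$. If $T>2\tau_{mix}\log\tau_{mix}$ and $\frac{c_1}{\tau_{mix}K\sqrt T}\le\alpha\le\frac{c_2}{\tau_{mix}K\sqrt T}$, then $$\mathbb E\|\nabla F(\tilde x_T)\|^2\le C\,\frac{\tau_{mix}(1+\log T)}{\sqrt T}+\frac CT+C_b\,(G^2+D^2)\,\Big\|\pi_R-\tfrac1N\mathbf 1\Big\|_1^2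 .$$ **Theorem (the bias is unavoidable).** Let $N=M=3$, $B=R=1$ and $p=(\frac14,\frac14,\frac12)$. Then $\pi_R=(\frac3{10},\frac3{10},\frac4{10})$. (a) For $f_i(x)=\frac12(x-i)^2$ on $\mathbb R$, every $x_0$, every $K\ge1$ and every constant stepsize $\alpha\in(0,2)$, $\mathbb E[x_t]\to\bar x:=\sum_i i\,\pi_R^i$. The point $\bar x$ is the unique minimizer of $\sum_i\pi_R^i f_i$, while $|F'(\bar x)|=|\sum_i i(\pi_R^i-\frac13)|=\frac1{10}$. (b) There are $f_1,f_2,f_3:\mathbb R\to\mathbb R$ that agree with the functions of (a) on $[1,3]$ and satisfy, for some constants $L,G,D,\Delta$, all hypotheses of the bound for every $x_0\in[1,3]$, and such that for all $K\ge1$ and $0<c_1\le c_2$ there is a $T_0$ with $$\mathbb E\|\nabla F(\tilde x_T)\|^2\ge\tfrac12\Big\|\pi_R-\tfrac13\mathbf 1\Big\|_1^2>0$$ for all $T\ge T_0$, all $x_0\in[1,3]$ and all $\alpha$ with $\frac{c_1}{\tau_{mix}K\sqrt T}\le\alpha\le\frac{c_2}{\tau_{mix}K\sqrt T}$. -/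

import Mathlib

open MeasureTheory ProbabilityTheory Filter Topology

noncomputable section

namespace FedAvgMC

/-! ### The participation chain with minimum separation `R` -/

/-- An ordered batch of `B` distinct clients out of `N`. -/
abbrev Batch (N B : ℕ) : Type := Fin B ↪ Fin N

instance instMeasurableSpaceBatch (N B : ℕ) : MeasurableSpace (Fin B ↪ Fin N) := ⊤

/-- The batches `y 0, y 1, …` are pairwise disjoint as sets of clients. -/
def Nonrepeated {N B R : ℕ} (y : Fin R → Batch N B) : Prop :=
  ∀ k l, k ≠ l → ∀ a b, y k a ≠ y l b

/-- No client of the batch `J` occurs in the window `y`. -/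
def Available {N B R : ℕ} (y : Fin R → Batch N B) (J : Batch N B) : Prop :=
  ∀ a k b, J a ≠ y k b

/-- `p_J`, the sum of the availability probabilities of the clients of `J`. -/
def batchWeight {N B : ℕ} (p : Fin N → ℝ) (J : Batch N B) : ℝ := ∑ a, p (J a)

open Classical in
/-- Probability that the next batch is `J` when the last `R` batches are `y 0` (most recent),
`y 1`, …, `y (R - 1)` (oldest). -/
def transProb {N B R : ℕ} (p : Fin N → ℝ) (y : Fin R → Batch N B) (J : Batch N B) : ℝ :=
  if Nonrepeated y ∧ Available y J then
    batchWeight p J / ∑ J' : Batch N B, if Available y J' then batchWeight p J' else 0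
  else 0

/-- State space of the augmented chain: windows of `R` pairwise disjoint batches. -/
def State (N B R : ℕ) : Type := {y : Fin R → Batch N B // Nonrepeated y}

instance instFintypeState (N B R : ℕ) : Fintype (State N B R) := by
  classical
  exact inferInstanceAs (Fintype {y : Fin R → Batch N B // Nonrepeated y})

instance instDecidableEqState (N B R : ℕ) : DecidableEq (State N B R) := Classical.decEq _

/-- The window after `J` has been sampled: `J` is put in front, the oldest batch is dropped. -/
def push {N B R : ℕ} (J : Batch N B) (y : Fin R → Batch N B) : Fin R → Batch N B :=
  fun k => if (k : ℕ) = 0 then J else y ⟨(k : ℕ) - 1, lt_of_le_of_lt (Nat.sub_le _ _) k.isLt⟩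

open Classical in
/-- Transition matrix `P_R` of the chain of windows. For `R ≥ 1` at most one `J` contributes to an
entry, namely the first batch of the target window; for `R = 0` there is a single state. -/
def transMatrix {N B : ℕ} (R : ℕ) (p : Fin N → ℝ) : Matrix (State N B R) (State N B R) ℝ :=
  fun y y' => ∑ J : Batch N B, if push J y.1 = y'.1 then transProb p y.1 J else 0

open Classical in
/-- The matrix `Q_R`: probability, given the current window, that the next batch has the client `i`
as its first entry. -/
def clientMatrix {N B : ℕ} [NeZero B] (R : ℕ) (p : Fin N → ℝ) : Matrix (State N B R) (Fin N) ℝ :=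
  fun y i => ∑ J : Batch N B, if J 0 = i then transProb p y.1 J else 0

/-- `ζ` is a stationary distribution of the stochastic matrix `P`. -/
structure IsStationary {S : Type*} [Fintype S] (P : Matrix S S ℝ) (ζ : S → ℝ) : Prop where
  nonneg : ∀ y, 0 ≤ ζ y
  sum_eq_one : ∑ y, ζ y = 1
  stationary : Matrix.vecMul ζ P = ζ

/-- `π_R = ζ_R Q_R`, the stationary distribution of the sampled clients. -/
def clientDist {N B : ℕ} [NeZero B] (R : ℕ) (p : Fin N → ℝ) (ζ : State N B R → ℝ) : Fin N → ℝ :=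
  Matrix.vecMul ζ (clientMatrix R p)

/-- The distance `‖π - (1/N) 𝟏‖₁`. -/
def biasL1 {N : ℕ} (π : Fin N → ℝ) : ℝ := ∑ i, |π i - 1 / (N : ℝ)|

/-- Total variation distance of two distributions on a finite set. -/
def tvDist {S : Type*} [Fintype S] (φ ψ : S → ℝ) : ℝ := (1 / 2) * ∑ y, |φ y - ψ y|

/-- Mixing time `τ_mix = inf {l ≥ 1 | max_y ‖P^l(y, ·) - ζ‖_TV ≤ 1/4}`. -/
def mixingTime {S : Type*} [Fintype S] [DecidableEq S] (P : Matrix S S ℝ) (ζ : S → ℝ) : ℕ :=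
  sInf {l : ℕ | 1 ≤ l ∧ ∀ y, tvDist ((P ^ l) y) ζ ≤ 1 / 4}

/-- The availability probabilities are strictly positive and sum to one. -/
structure IsAvailability {N : ℕ} (p : Fin N → ℝ) : Prop where
  pos : ∀ i, 0 < p i
  sum_eq_one : ∑ i, p i = 1

/-- `X` is the `R`-order Markov chain of sampled batches with availability probabilities `p`:
the first `R` batches are pairwise disjoint with an otherwise arbitrary joint law, and from round
`R` on the next batch is drawn by `transProb` from the last `R` batches, given the whole past. -/
structure IsParticipation {N B : ℕ} (R : ℕ) (p : Fin N → ℝ) {Ω : Type*} [MeasurableSpace Ω]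
    (μ : Measure Ω) (X : ℕ → Ω → Batch N B) : Prop where
  measurable : ∀ t, Measurable (X t)
  initial : ∀ᵐ ω ∂μ, Nonrepeated (fun k : Fin R => X k ω)
  markov : ∀ t, R ≤ t → ∀ x : ℕ → Batch N B,
    μ.real {ω | ∀ s, s ≤ t → X s ω = x s} =
      μ.real {ω | ∀ s, s < t → X s ω = x s} *
        transProb p (fun k : Fin R => x (t - 1 - k)) (x t)

/-- `I` is uniformly distributed on `{0, …, T - 1}` and independent of the process `X`. -/
structure IsUniformIndex {N B T : ℕ} {Ω : Type*} [MeasurableSpace Ω]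
    (μ : Measure Ω) (X : ℕ → Ω → Batch N B) (I : Ω → Fin T) : Prop where
  measurable : Measurable I
  uniform : ∀ i, μ.real {ω | I ω = i} = 1 / (T : ℝ)
  indep : IndepFun I (fun ω t => X t ω) μ

/-! ### FedAvg -/

section Algorithm

variable {E : Type*} [NormedAddCommGroup E] [InnerProductSpace ℝ E] [CompleteSpace E]

/-- The global objective `F = (1/N) ∑ f_i`. -/
def globalObj {N : ℕ} (f : Fin N → E → ℝ) : E → ℝ := fun x => (1 / (N : ℝ)) * ∑ i, f i x

/-- `K` local gradient descent steps with stepsize `α` on `g`, started at `x`. -/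
def localSteps (g : E → ℝ) (α : ℝ) (K : ℕ) (x : E) : E :=
  (fun z => z - α • gradient g z)^[K] x

/-- Server iterates of FedAvg started at `x₀`, when the batches `S 0, S 1, …` are sampled. -/
def fedAvg {N B : ℕ} (f : Fin N → E → ℝ) (α : ℝ) (K : ℕ) (x₀ : E) (S : ℕ → Batch N B) : ℕ → E
  | 0 => x₀
  | t + 1 => (1 / (B : ℝ)) • ∑ a : Fin B, localSteps (f (S t a)) α K (fedAvg f α K x₀ S t)

/-- `L`-smoothness of all `f_i`, heterogeneity bounded by `G`, and `‖∇F‖` bounded by `D`. -/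
structure IsRegular {N : ℕ} (f : Fin N → E → ℝ) (L G D : ℝ) : Prop where
  differentiable : ∀ i, Differentiable ℝ (f i)
  smooth : ∀ i x y, ‖gradient (f i) x - gradient (f i) y‖ ≤ L * ‖x - y‖
  hetero : ∀ i x, ‖gradient (f i) x - gradient (globalObj f) x‖ ^ 2 ≤ G ^ 2
  gradBound : ∀ x, ‖gradient (globalObj f) x‖ ≤ D

/-- `E ‖∇F(x̃_T)‖²` for the output `x̃_T = x_I`. -/
def outputSqGrad {N B T : ℕ} {Ω : Type*} [MeasurableSpace Ω] (μ : Measure Ω)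
    (f : Fin N → E → ℝ) (α : ℝ) (K : ℕ) (x₀ : E) (X : ℕ → Ω → Batch N B) (I : Ω → Fin T) : ℝ :=
  ∫ ω, ‖gradient (globalObj f) (fedAvg f α K x₀ (fun t => X t ω) (I ω))‖ ^ 2 ∂μ

end Algorithm

/-- `α` is of order `1 / (τ K √T)`, with constants `c₁` and `c₂`. -/
def StepsizeOrder (c₁ c₂ : ℝ) (τ K T : ℕ) (α : ℝ) : Prop :=
  c₁ / ((τ : ℝ) * K * √(T : ℝ)) ≤ α ∧ α ≤ c₂ / ((τ : ℝ) * K * √(T : ℝ))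

/-! ### Data of the three-client example -/

/-- Availability probabilities `(1/4, 1/4, 1/2)`. -/
def exampleAvail : Fin 3 → ℝ := ![1 / 4, 1 / 4, 1 / 2]

/-- `f_i(x) = (x - i)² / 2` for the clients `i = 1, 2, 3` (numbered from `0` here). -/
def exampleLoss : Fin 3 → ℝ → ℝ := fun i x => (1 / 2) * (x - ((i : ℕ) + 1 : ℝ)) ^ 2

end FedAvgMC

end

/-! Ergodicity. Place all clients on a cycle of `M` blocks of size `B`, the window being the `R`
blocks behind block `0`. A step of the chain rotates the cycle by one block, and since `R + 2 ≤ M`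
blocks `0` and `1` are both outside the window, so their clients may be exchanged before rotating
(`transMatrix_windowOf_pos`). Conjugating by rotations realises every transposition between adjacent
blocks in exactly `M` steps (`reachable_swap`). These generate the symmetric group, and full
rotations equalise the lengths of the paths, so some power of the transition matrix is positive. A
Doeblin contraction on vectors of sum zero then gives uniqueness and convergence.

Bound. One round decreases `F` by `α K ⟨∇F(x), g⟩` up to second order, where `g` is the average
gradient of the sampled batch. The batch is correlated with the iterate, so the inner product is
evaluated at the iterate of `s` rounds earlier. This costs `O(s α K)`, and given that older past the
batch is nearly stationary (`abs_integral_next_sub_le`). By exchangeability within a batch every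
entry then has law `π_R`, and `inner_weighted_gradient_ge` gives half the squared gradient minus the
bias term. With `s = τ (log₂ T + 1)` the distance from stationarity is `O(1 / T)`. The first `R + s`
rounds are bounded crudely; they are affordable because `R ≤ τ` (`le_of_tvDist_pow_le`). Telescoping
finishes the proof (`outputSqGrad_le_of_mixed`, `outputSqGrad_le`).

Sharpness. With one client per round and unit quadratics, a round contracts the iterate towards the
center of the sampled client by the factor `(1 - α) ^ K`. The mean iterate thus obeys a linear
recursion driven by the mean center, which converges to `21 / 10` because the other eigenvalues of
the client chain are `-2/3` and `-1/3`. Quadratics continued affinely outside `[1, 3]` meet the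
boundedness assumptions and leave trajectories in `[1, 3]` unchanged when `α ≤ 1`. Telescoping the
recursion keeps the time average of the means near `21 / 10`, and convexity of the square transfers
this to the squared gradient. -/

namespace FedAvgMC

/-! ### Contraction and mixing of finite stochastic matrices -/

section FiniteChain

open Matrix

variable {S : Type*} [Fintype S]

lemma sum_vecMul_of_rowSum {P : Matrix S S ℝ} (hP : ∀ y, ∑ y', P y y' = 1) (v : S → ℝ) :
    ∑ y', (v ᵥ* P) y' = ∑ y, v y := by
  simp only [vecMul, dotProduct]
  rw [Finset.sum_comm]
  simp [← Finset.mul_sum, hP]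

/-- If all rows of `Q` are within `r` of a common vector in `ℓ¹`, then `Q` contracts vectors with
vanishing sum by the factor `r`. -/
lemma sum_abs_vecMul_le {Q : Matrix S S ℝ} {c : S → ℝ} {r : ℝ}
    (hQ : ∀ y, ∑ y', |Q y y' - c y'| ≤ r) {v : S → ℝ} (hv : ∑ y, v y = 0) :
    ∑ y', |(v ᵥ* Q) y'| ≤ r * ∑ y, |v y| := by
  have h1 : ∀ y', (v ᵥ* Q) y' = ∑ y, v y * (Q y y' - c y') := fun y' => by
    simp only [vecMul, dotProduct, mul_sub, Finset.sum_sub_distrib, ← Finset.sum_mul, hv,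
      zero_mul, sub_zero]
  calc ∑ y', |(v ᵥ* Q) y'| ≤ ∑ y', ∑ y, |v y| * |Q y y' - c y'| := by
        refine Finset.sum_le_sum fun y' _ => ?_
        rw [h1]
        refine (Finset.abs_sum_le_sum_abs _ _).trans_eq ?_
        simp [abs_mul]
    _ = ∑ y, |v y| * ∑ y', |Q y y' - c y'| := by
        rw [Finset.sum_comm]; simp [Finset.mul_sum]
    _ ≤ ∑ y, |v y| * r := by gcongr with y; exact hQ y
    _ = r * ∑ y, |v y| := by rw [← Finset.sum_mul, mul_comm]

variable [DecidableEq S]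

/-- Unit row sums keep the sum of the vector equal to zero, so the one-step contraction can be
iterated. It is used both with `c` a multiple of a point mass (Doeblin) and with `c` the stationary
law (mixing time). -/
lemma sum_abs_vecMul_pow_le {Q : Matrix S S ℝ} (hs : ∀ y, ∑ y', Q y y' = 1) {c : S → ℝ} {r : ℝ}
    (hr : 0 ≤ r) (hQ : ∀ y, ∑ y', |Q y y' - c y'| ≤ r) {v : S → ℝ} (hv : ∑ y, v y = 0) (k : ℕ) :
    ∑ y', |(v ᵥ* Q ^ k) y'| ≤ r ^ k * ∑ y, |v y| := by
  have hk : ∀ k : ℕ, ∑ y', (v ᵥ* Q ^ k) y' = 0 := fun k => by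
    induction k with
    | zero => simpa using hv
    | succ k ih => rw [pow_succ, ← vecMul_vecMul, sum_vecMul_of_rowSum hs, ih]
  induction k with
  | zero => simp
  | succ k ih =>
    rw [pow_succ, ← vecMul_vecMul]
    refine (sum_abs_vecMul_le hQ (hk k)).trans ?_
    calc r * _ ≤ r * (r ^ k * ∑ y, |v y|) := by gcongr
      _ = _ := by ring

lemma row_eq_vecMul (P : Matrix S S ℝ) (y : S) : P y = Pi.single y 1 ᵥ* P := by
  rw [single_one_vecMul]; rfl

lemma vecMul_pow_of_fixed {P : Matrix S S ℝ} {v : S → ℝ} (h : v ᵥ* P = v) (t : ℕ) :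
    v ᵥ* P ^ t = v := by
  induction t with
  | zero => simp
  | succ t ih => rw [pow_succ, ← vecMul_vecMul, ih, h]

variable {P : Matrix S S ℝ} (hP : P ∈ rowStochastic ℝ S)

include hP

lemma sum_abs_vecMul_le_of_stochastic (v : S → ℝ) : ∑ y', |(v ᵥ* P) y'| ≤ ∑ y, |v y| := by
  calc ∑ y', |(v ᵥ* P) y'| ≤ ∑ y', ∑ y, |v y| * P y y' := by
        refine Finset.sum_le_sum fun y' _ => (Finset.abs_sum_le_sum_abs _ _).trans_eq ?_
        simp [abs_mul, abs_of_nonneg (nonneg_of_mem_rowStochastic hP)]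
    _ = ∑ y, |v y| := by
        rw [Finset.sum_comm]
        simp [← Finset.mul_sum, sum_row_of_mem_rowStochastic hP]

/-- Doeblin's argument: all rows of `P ^ n` dominate the mass `δ` at `z`, so they lie within `1 - δ`
of that common vector in `ℓ¹`. -/
lemma tendsto_vecMul_pow_of_column {n : ℕ} (hn : 0 < n) {z : S} (hz : ∀ y, 0 < (P ^ n) y z)
    {v : S → ℝ} (hv : ∑ y, v y = 0) :
    Tendsto (fun t : ℕ => ∑ y, |(v ᵥ* P ^ t) y|) atTop (𝓝 0) := by
  have hPn : P ^ n ∈ rowStochastic ℝ S := pow_mem hP n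
  have : Nonempty S := ⟨z⟩
  obtain ⟨y₀, hy₀⟩ := Finite.exists_min fun y => (P ^ n) y z
  set δ := (P ^ n) y₀ z with hδ
  have hδ1 : δ ≤ 1 := le_one_of_mem_rowStochastic hPn
  have hδ0 : 0 < δ := hz y₀
  have hrow : ∀ y, ∑ y', |(P ^ n) y y' - (Pi.single z δ : S → ℝ) y'| ≤ 1 - δ := fun y => by
    have : ∀ y', |(P ^ n) y y' - (Pi.single z δ : S → ℝ) y'|
        = (P ^ n) y y' - (Pi.single z δ : S → ℝ) y' := fun y' => by
      refine abs_of_nonneg ?_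
      by_cases h : y' = z
      · subst h; simpa using hy₀ y
      · simpa [h] using nonneg_of_mem_rowStochastic hPn
    simp [this, Finset.sum_sub_distrib, sum_row_of_mem_rowStochastic hPn]
  have key := sum_abs_vecMul_pow_le (fun y => sum_row_of_mem_rowStochastic hPn y)
    (sub_nonneg.2 hδ1) hrow hv
  have hbound : ∀ t, ∑ y, |(v ᵥ* P ^ t) y| ≤ (1 - δ) ^ (t / n) * ∑ y, |v y| := fun t => by
    have ht : P ^ t = (P ^ n) ^ (t / n) * P ^ (t % n) := by
      rw [← pow_mul, ← pow_add, Nat.div_add_mod]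
    rw [ht, ← vecMul_vecMul]
    exact (sum_abs_vecMul_le_of_stochastic (pow_mem hP _) _).trans (key _)
  refine squeeze_zero (fun t => Finset.sum_nonneg fun _ _ => abs_nonneg _) hbound ?_
  rw [← zero_mul (∑ y, |v y|)]
  exact ((tendsto_pow_atTop_nhds_zero_of_lt_one (by linarith) (by linarith)).comp
    (Nat.tendsto_div_const_atTop hn.ne')).mul_const _

lemma tendsto_pow_of_column {n : ℕ} (hn : 0 < n) {z : S} (hz : ∀ y, 0 < (P ^ n) y z)
    {ζ : S → ℝ} (h1 : ∑ y, ζ y = 1) (hs : ζ ᵥ* P = ζ) (y y' : S) :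
    Tendsto (fun t : ℕ => (P ^ t) y y') atTop (𝓝 (ζ y')) := by
  have h := tendsto_vecMul_pow_of_column hP hn hz (v := Pi.single y 1 - ζ) (by simp [h1])
  rw [tendsto_iff_dist_tendsto_zero]
  refine squeeze_zero (fun _ => dist_nonneg) (fun t => ?_) h
  rw [Real.dist_eq]
  have : (P ^ t) y y' - ζ y' = ((Pi.single y 1 - ζ) ᵥ* P ^ t) y' := by
    rw [sub_vecMul, vecMul_pow_of_fixed hs, Pi.sub_apply, ← row_eq_vecMul]
  rw [this]
  exact Finset.single_le_sum (f := fun y' => |((Pi.single y 1 - ζ) ᵥ* P ^ t) y'|)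
    (fun _ _ => abs_nonneg _) (Finset.mem_univ y')

/-- A stochastic matrix with a power that has a positive column has a unique stationary
distribution. -/
theorem existsUnique_isStationary_of_column {n : ℕ} (hn : 0 < n) {z : S}
    (hz : ∀ y, 0 < (P ^ n) y z) : ∃! ζ : S → ℝ, IsStationary P ζ := by
  have : Nonempty S := ⟨z⟩
  -- The constant vector is a right fixed vector, so `P - 1` is singular and a left fixed vector
  -- exists as well.
  have hdet : (P - 1).det = 0 := by
    rw [← exists_mulVec_eq_zero_iff]
    refine ⟨1, one_ne_zero, ?_⟩
    rw [sub_mulVec, (mem_rowStochastic.1 hP).2, one_mulVec, sub_self]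
  obtain ⟨v, hv0, hv⟩ := exists_vecMul_eq_zero_iff.2 hdet
  have hvP : v ᵥ* P = v := by
    rw [vecMul_sub, vecMul_one, sub_eq_zero] at hv; exact hv
  -- A fixed vector of sum zero would also be contracted to zero, hence vanish; so `v` can be
  -- normalised.
  have hsum : ∑ y, v y ≠ 0 := fun h0 => by
    have h := tendsto_vecMul_pow_of_column hP hn hz h0
    simp only [vecMul_pow_of_fixed hvP] at h
    have := tendsto_nhds_unique h tendsto_const_nhds
    apply hv0
    ext y
    have := (Finset.sum_eq_zero_iff_of_nonneg (fun _ _ => abs_nonneg _)).1 this.symm y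
      (Finset.mem_univ y)
    simpa using this
  set ζ : S → ℝ := (∑ y, v y)⁻¹ • v with hζ
  have hζ1 : ∑ y, ζ y = 1 := by
    simp [hζ, ← Finset.mul_sum, hsum]
  have hζP : ζ ᵥ* P = ζ := by rw [hζ, smul_vecMul, hvP]
  have hlim := fun y y' => tendsto_pow_of_column hP hn hz hζ1 hζP y y'
  refine ⟨ζ, ⟨fun y' => ?_, hζ1, hζP⟩, fun ξ hξ => ?_⟩
  · exact ge_of_tendsto' (hlim z y') fun t => nonneg_of_mem_rowStochastic (pow_mem hP t)
  · ext y'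
    exact tendsto_nhds_unique (tendsto_pow_of_column hP hn hz hξ.sum_eq_one hξ.stationary z y')
      (hlim z y')

omit hP in
lemma one_le_mixingTime {ζ : S → ℝ}
    (hlim : ∀ y y', Tendsto (fun t : ℕ => (P ^ t) y y') atTop (𝓝 (ζ y'))) :
    1 ≤ mixingTime P ζ ∧ ∀ y, tvDist ((P ^ mixingTime P ζ) y) ζ ≤ 1 / 4 := by
  refine Nat.sInf_mem (s := {l : ℕ | 1 ≤ l ∧ ∀ y, tvDist ((P ^ l) y) ζ ≤ 1 / 4}) ?_
  have htv : ∀ y, ∀ᶠ t : ℕ in atTop, tvDist ((P ^ t) y) ζ ≤ 1 / 4 := fun y => by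
    have : Tendsto (fun t : ℕ => tvDist ((P ^ t) y) ζ) atTop
        (𝓝 ((1 / 2) * ∑ y', |ζ y' - ζ y'|)) :=
      (tendsto_finsetSum _ fun y' _ => ((hlim y y').sub_const _).abs).const_mul _
    simp only [sub_self, abs_zero, Finset.sum_const_zero, mul_zero] at this
    exact this.eventually_le_const (by norm_num)
  obtain ⟨l, h1, h2⟩ := ((eventually_ge_atTop 1).and (eventually_all.2 htv)).exists
  exact ⟨l, h1, h2⟩

/-- Total variation `1 / 4` is `ℓ¹` distance `1 / 2`, so `P ^ τ` halves vectors of sum zero. The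
factor `2` bounds the `ℓ¹` norm of a point mass minus `ζ`. -/
lemma sum_abs_pow_mul_sub_le {ζ : S → ℝ} (hζ : IsStationary P ζ) {τ : ℕ}
    (hτ : ∀ y, tvDist ((P ^ τ) y) ζ ≤ 1 / 4) (k : ℕ) (y : S) :
    ∑ y', |(P ^ (τ * k)) y y' - ζ y'| ≤ 2 * (1 / 2) ^ k := by
  have h := sum_abs_vecMul_pow_le (Q := P ^ τ) (c := ζ) (r := 1 / 2)
    (fun y => sum_row_of_mem_rowStochastic (pow_mem hP _) y) (by norm_num)
    (fun y => by have := hτ y; unfold tvDist at this; linarith)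
    (v := Pi.single y 1 - ζ) (by simp [hζ.sum_eq_one]) k
  rw [← pow_mul, sub_vecMul, vecMul_pow_of_fixed hζ.stationary, ← row_eq_vecMul] at h
  refine h.trans ?_
  rw [mul_comm]
  gcongr
  calc ∑ x, |(Pi.single y 1 - ζ : S → ℝ) x| ≤ ∑ x, ((Pi.single y 1 : S → ℝ) x + ζ x) := by
        refine Finset.sum_le_sum fun x _ => (abs_sub _ _).trans_eq ?_
        rw [abs_of_nonneg (hζ.nonneg x), abs_of_nonneg (by rw [Pi.single_apply]; split_ifs <;> simp)]
    _ = 2 := by simp [Finset.sum_add_distrib, hζ.sum_eq_one]; norm_num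

end FiniteChain

/-! ### Irreducibility and aperiodicity of the chain of windows -/

section Ergodicity

open Matrix

variable {N M B R : ℕ}

lemma batchWeight_pos [NeZero B] {p : Fin N → ℝ} (hp : IsAvailability p) (J : Batch N B) :
    0 < batchWeight p J :=
  Finset.sum_pos (fun a _ => hp.pos (J a)) Finset.univ_nonempty

open Classical in
lemma availableWeight_pos [NeZero B] {p : Fin N → ℝ} (hp : IsAvailability p)
    {y : Fin R → Batch N B} {J : Batch N B} (hJ : Available y J) :
    0 < ∑ J' : Batch N B, if Available y J' then batchWeight p J' else 0 := by
  refine Finset.sum_pos' (fun J' _ => ?_) ⟨J, Finset.mem_univ _, ?_⟩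
  · split_ifs
    exacts [(batchWeight_pos hp _).le, le_rfl]
  · rw [if_pos hJ]; exact batchWeight_pos hp J

lemma transProb_pos [NeZero B] {p : Fin N → ℝ} (hp : IsAvailability p) {y : Fin R → Batch N B}
    {J : Batch N B} (hy : Nonrepeated y) (hJ : Available y J) : 0 < transProb p y J := by
  rw [transProb, if_pos ⟨hy, hJ⟩]
  exact div_pos (batchWeight_pos hp J) (availableWeight_pos hp hJ)

lemma transProb_nonneg [NeZero B] {p : Fin N → ℝ} (hp : IsAvailability p) (y : Fin R → Batch N B)
    (J : Batch N B) : 0 ≤ transProb p y J := by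
  by_cases h : Nonrepeated y ∧ Available y J
  · exact (transProb_pos hp h.1 h.2).le
  · rw [transProb, if_neg h]

lemma transProb_eq_zero {p : Fin N → ℝ} {y : Fin R → Batch N B} {J : Batch N B}
    (h : ¬(Nonrepeated y ∧ Available y J)) : transProb p y J = 0 := if_neg h

lemma nonrepeated_push {y : Fin R → Batch N B} {J : Batch N B} (hy : Nonrepeated y)
    (hJ : Available y J) : Nonrepeated (push J y) := by
  intro k l hkl a b
  unfold push
  have hne : (k : ℕ) ≠ l := fun h => hkl (Fin.ext h)
  split_ifs with h1 h2 h2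
  · omega
  · exact hJ _ _ _
  · exact (hJ _ _ _).symm
  · exact hy _ _ (fun h => by simp only [Fin.mk.injEq] at h; omega) _ _

lemma sum_transProb [NeZero B] {p : Fin N → ℝ} (hp : IsAvailability p) {y : Fin R → Batch N B}
    (hy : Nonrepeated y) (hJ : ∃ J : Batch N B, Available y J) : ∑ J, transProb p y J = 1 := by
  classical
  obtain ⟨J, hJ⟩ := hJ
  have hne := (availableWeight_pos hp hJ).ne'
  rw [← div_self hne, Finset.sum_div]
  refine Finset.sum_congr rfl fun J' _ => ?_
  by_cases h : Available y J'
  · simp only [transProb, hy, h, and_self, if_true]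
  · simp [transProb, h]

/-- One step of the window operator. -/
lemma sum_transMatrix_mul {p : Fin N → ℝ} (y : State N B R) (g : (Fin R → Batch N B) → ℝ) :
    ∑ y', transMatrix R p y y' * g y'.1 = ∑ J, transProb p y.1 J * g (push J y.1) := by
  classical
  simp only [transMatrix, Finset.sum_mul]
  rw [Finset.sum_comm]
  refine Finset.sum_congr rfl fun J _ => ?_
  by_cases h : Nonrepeated y.1 ∧ Available y.1 J
  · rw [Finset.sum_eq_single ⟨push J y.1, nonrepeated_push h.1 h.2⟩]
    · simp
    · intro y' _ hy'
      rw [if_neg fun he => hy' (Subtype.ext he.symm), zero_mul]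
    · exact fun h => absurd (Finset.mem_univ _) h
  · simp [transProb_eq_zero h]

lemma transMatrix_nonneg [NeZero B] {p : Fin N → ℝ} (hp : IsAvailability p) (y y' : State N B R) :
    0 ≤ transMatrix R p y y' := by
  classical
  refine Finset.sum_nonneg fun J _ => ?_
  split_ifs
  exacts [transProb_nonneg hp _ _, le_rfl]

lemma transMatrix_pos [NeZero B] {p : Fin N → ℝ} (hp : IsAvailability p) {y y' : State N B R}
    {J : Batch N B} (hJ : Available y.1 J) (h : push J y.1 = y'.1) :
    0 < transMatrix R p y y' := by
  classical
  refine Finset.sum_pos' (fun J' _ => ?_) ⟨J, Finset.mem_univ _, ?_⟩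
  · split_ifs
    exacts [transProb_nonneg hp _ _, le_rfl]
  · rw [if_pos h]; exact transProb_pos hp y.2 hJ

/-- An arrangement of all clients in a cycle of `M` blocks of size `B`. -/
abbrev Arrangement (N M B : ℕ) : Type := (ZMod M × Fin B) ≃ Fin N

lemma neg_succ_ne_zero {k : ℕ} (hk : k + 1 < M) : (-((k : ZMod M) + 1) : ZMod M) ≠ 0 := by
  rw [neg_ne_zero]
  intro h
  have h' : ((k + 1 : ℕ) : ZMod M) = 0 := by push_cast; exact h
  rw [ZMod.natCast_eq_zero_iff] at h'
  exact absurd (Nat.le_of_dvd (by omega) h') (by omega)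

/-- Block `1` is outside the window. This is the place where `R + 2 ≤ M` enters; `R + 1 ≤ M` would
free block `0` only. -/
lemma neg_succ_ne_one {k : ℕ} (hk : k + 2 < M) : (-((k : ZMod M) + 1) : ZMod M) ≠ 1 := by
  intro h
  have h' : ((k + 2 : ℕ) : ZMod M) = 0 := by push_cast; linear_combination -h
  rw [ZMod.natCast_eq_zero_iff] at h'
  exact absurd (Nat.le_of_dvd (by omega) h') (by omega)

lemma neg_succ_inj {k l : ℕ} (hk : k < M) (hl : l < M)
    (h : (-((k : ZMod M) + 1) : ZMod M) = -((l : ZMod M) + 1)) : k = l := by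
  have h' : (k : ZMod M) = l := by linear_combination -h
  rw [ZMod.natCast_eq_natCast_iff'] at h'
  rwa [Nat.mod_eq_of_lt hk, Nat.mod_eq_of_lt hl] at h'

/-- The window consisting of the last `R` blocks of an arrangement. -/
def windowOf (hR : R ≤ M) (e : Arrangement N M B) : State N B R :=
  ⟨fun k => ⟨fun b => e (-((k : ℕ) + 1), b), fun b b' h => by simpa using h⟩,
    fun k l hkl a b h => by
      have h' := congrArg Prod.fst (e.injective h)
      exact hkl (Fin.ext (neg_succ_inj (by omega) (by omega) h'))⟩

lemma windowOf_apply (hR : R ≤ M) (e : Arrangement N M B) (k : Fin R) (b : Fin B) :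
    (windowOf hR e).1 k b = e (-((k : ℕ) + 1), b) := rfl

/-- The clients of a window are distinct, so the map sending the window positions of a reference
arrangement to them is a partial injection of a finite set, which extends to a permutation. -/
lemma exists_windowOf_eq [NeZero M] (hN : N = M * B) (hR : R ≤ M) (y : State N B R) :
    ∃ e : Arrangement N M B, windowOf hR e = y := by
  classical
  have hcard : Fintype.card (ZMod M × Fin B) = Fintype.card (Fin N) := by
    simp [ZMod.card, hN]
  let e₀ : Arrangement N M B := Fintype.equivOfCardEq hcard
  let i : Fin R × Fin B → Fin N := fun x => e₀ (-((x.1 : ℕ) + 1), x.2)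
  have hi : Function.Injective i := fun x x' h => by
    have h' := e₀.injective h
    rw [Prod.mk.injEq] at h'
    exact Prod.ext (Fin.ext (neg_succ_inj (by omega) (by omega) h'.1)) h'.2
  let j : Fin R × Fin B → Fin N := fun x => y.1 x.1 x.2
  have hj : Function.Injective j := fun x x' h => by
    have h1 : x.1 = x'.1 := by_contra fun hne => y.2 _ _ hne _ _ h
    refine Prod.ext h1 ?_
    simp only [j, h1] at h
    exact (y.1 x'.1).injective h
  let q : {x // x ∈ Set.range i} ≃ {x // x ∈ Set.range j} :=
    (Equiv.ofInjective i hi).symm.trans (Equiv.ofInjective j hj)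
  refine ⟨e₀.trans q.extendSubtype, Subtype.ext (funext fun k => DFunLike.ext _ _ fun b => ?_)⟩
  rw [windowOf_apply, Equiv.trans_apply]
  change q.extendSubtype (i (k, b)) = j (k, b)
  rw [Equiv.extendSubtype_apply_of_mem _ _ ⟨(k, b), rfl⟩]
  have : (Equiv.ofInjective i hi).symm ⟨i (k, b), ⟨(k, b), rfl⟩⟩ = (k, b) := by
    rw [Equiv.symm_apply_eq]; rfl
  simp only [q, Equiv.trans_apply, this]
  rfl

/-- Rotation of the cycle by one block. -/
def blockRotation (M B : ℕ) : Equiv.Perm (ZMod M × Fin B) :=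
  (Equiv.addRight (1 : ZMod M)).prodCongr (Equiv.refl _)

lemma blockRotation_apply (x : ZMod M × Fin B) : blockRotation M B x = (x.1 + 1, x.2) := rfl

lemma blockRotation_pow_apply (j : ℕ) (x : ZMod M × Fin B) :
    (blockRotation M B ^ j) x = (x.1 + j, x.2) := by
  induction j with
  | zero => simp
  | succ j ih =>
    rw [pow_succ', Equiv.Perm.mul_apply, ih, blockRotation_apply]
    push_cast
    rw [add_assoc]

lemma blockRotation_pow_card : blockRotation M B ^ M = 1 := by
  ext x <;> simp [blockRotation_pow_apply]

variable [NeZero B] {p : Fin N → ℝ}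

omit [NeZero B] in
lemma exists_available [NeZero M] (hN : N = M * B) (hR : R + 1 ≤ M) (y : State N B R) :
    ∃ J : Batch N B, Available y.1 J := by
  obtain ⟨e, rfl⟩ := exists_windowOf_eq hN (by omega) y
  refine ⟨⟨fun b => e (0, b), fun b b' h => by simpa using h⟩, fun a k b h => ?_⟩
  have h' := congrArg Prod.fst (e.injective h)
  exact neg_succ_ne_zero (by omega) h'.symm

lemma transMatrix_mem_rowStochastic (hN : N = M * B) (hR : R + 1 ≤ M) (hp : IsAvailability p) :
    transMatrix R p ∈ rowStochastic ℝ (State N B R) := by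
  have : NeZero M := ⟨by omega⟩
  rw [mem_rowStochastic_iff_sum]
  refine ⟨transMatrix_nonneg hp, fun y => ?_⟩
  have h := sum_transMatrix_mul (p := p) y fun _ => 1
  simp only [mul_one] at h
  rw [h, sum_transProb hp y.2 (exists_available hN hR y)]

/-- A permutation `σ` supported on the two free blocks does not touch the window, and `σ` decides
which clients fill block `0`, the batch sampled next. -/
lemma transMatrix_windowOf_pos (hR : R + 2 ≤ M) (hp : IsAvailability p) (e : Arrangement N M B)
    {σ : Equiv.Perm (ZMod M × Fin B)} (hσ : ∀ x, x.1 ≠ 0 → x.1 ≠ 1 → σ x = x) :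
    0 < transMatrix R p (windowOf (by omega) e)
      (windowOf (by omega) ((σ * blockRotation M B).trans e)) := by
  refine transMatrix_pos hp (J := ⟨fun b => e (σ (0, b)), fun b b' h => by simpa using h⟩) ?_ ?_
  · intro a k b h
    rw [windowOf_apply] at h
    have h1 := e.injective h
    rw [← hσ (_, b) (neg_succ_ne_zero (by omega)) (neg_succ_ne_one (by omega))] at h1
    exact neg_succ_ne_zero (M := M) (k := k) (by omega)
      (congrArg Prod.fst (σ.injective h1)).symm
  · refine funext fun k => DFunLike.ext _ _ fun b => ?_
    rw [windowOf_apply, Equiv.trans_apply, Equiv.Perm.mul_apply, blockRotation_apply]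
    unfold push
    split_ifs with h
    · simp only [h, Nat.cast_zero, zero_add, neg_add_cancel]; rfl
    · rw [windowOf_apply]
      have hc : (-(((k : ℕ) : ZMod M) + 1) + 1 : ZMod M) = -((((k : ℕ) - 1 : ℕ) : ZMod M) + 1) := by
        rw [Nat.cast_sub (by omega)]; push_cast; ring
      simp only [hc]
      rw [hσ (_, b) (neg_succ_ne_zero (by omega)) (neg_succ_ne_one (by omega))]

/-- The rearrangement `g` of the blocks can be achieved in `n` steps of the chain. -/
def Reachable (R : ℕ) (p : Fin N → ℝ) (hR : R ≤ M) (n : ℕ)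
    (g : Equiv.Perm (ZMod M × Fin B)) : Prop :=
  ∀ e : Arrangement N M B, 0 < (transMatrix R p ^ n) (windowOf hR e) (windowOf hR (g.trans e))

omit [NeZero B] in
/-- In `l` steps the batches of the window move back by `l` places. -/
lemma eq_of_transMatrix_pow_ne_zero {l : ℕ} {y y' : State N B R}
    (h : (transMatrix R p ^ l) y y' ≠ 0) (k : Fin R) (hk : l ≤ k) :
    y'.1 k = y.1 ⟨k - l, by omega⟩ := by
  classical
  induction l generalizing y' k with
  | zero =>
    rw [pow_zero, Matrix.one_apply] at h
    have : y = y' := by_contra fun hne => h (if_neg hne)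
    simp [this]
  | succ l ih =>
    rw [pow_succ, Matrix.mul_apply] at h
    obtain ⟨x, -, hx⟩ := Finset.exists_ne_zero_of_sum_ne_zero h
    obtain ⟨J, -, hJ⟩ := Finset.exists_ne_zero_of_sum_ne_zero (right_ne_zero_of_mul hx)
    have hpush : push J x.1 = y'.1 := by_contra fun hne => hJ (if_neg hne)
    rw [← hpush, push, if_neg (by omega), ih (left_ne_zero_of_mul hx) _ (by simp only; omega)]
    exact congrArg y.1 (Fin.ext (by simp only; omega))

variable (hR : R + 2 ≤ M) (hp : IsAvailability p)

include hp in
lemma transMatrix_pow_nonneg (n : ℕ) (y y' : State N B R) : 0 ≤ (transMatrix R p ^ n) y y' := by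
  induction n generalizing y' with
  | zero => rw [pow_zero, Matrix.one_apply]; split_ifs <;> simp
  | succ n ih =>
    rw [pow_succ, Matrix.mul_apply]
    exact Finset.sum_nonneg fun _ _ => mul_nonneg (ih _) (transMatrix_nonneg hp _ _)

include hp in
lemma Reachable.mul {hR : R ≤ M} {m n : ℕ} {g h : Equiv.Perm (ZMod M × Fin B)}
    (hg : Reachable R p hR m g) (hh : Reachable R p hR n h) :
    Reachable R p hR (m + n) (g * h) := fun e => by
  rw [pow_add, Matrix.mul_apply]
  refine Finset.sum_pos' (fun y _ => mul_nonneg (transMatrix_pow_nonneg hp _ _ _)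
    (transMatrix_pow_nonneg hp _ _ _)) ⟨windowOf hR (g.trans e), Finset.mem_univ _, ?_⟩
  exact mul_pos (hg e) (hh (g.trans e))

include hp in
lemma reachable_rotation_pow (n : ℕ) : Reachable R p (by omega : R ≤ M) n (blockRotation M B ^ n) := by
  induction n with
  | zero => intro e; rw [pow_zero, pow_zero]; simp [Matrix.one_apply, Equiv.Perm.one_def]
  | succ n ih =>
    rw [pow_succ]
    refine ih.mul hp fun e => ?_
    have := transMatrix_windowOf_pos hR hp e (σ := 1) fun _ _ _ => rfl
    rwa [one_mul, ← pow_one (transMatrix R p)] at this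

-- Rotate `j` blocks, exchange the two clients while sampling, then complete the turn: `j + 1 + (M -
-- 1 - j) = M` steps. As the `M`-th power of the rotation is the identity, the product is the
-- exchange in blocks `0` and `1` conjugated by the `j`-th power of the rotation.
include hp in
lemma reachable_swap {j : ℕ} (hj : j < M) (b b' : Fin B) :
    Reachable R p (by omega : R ≤ M) M (Equiv.swap ((j : ZMod M), b) ((j : ZMod M) + 1, b')) := by
  have h1 : Reachable R p (by omega : R ≤ M) 1
      (Equiv.swap ((0 : ZMod M), b) (1, b') * blockRotation M B) := fun e => by
    rw [pow_one]
    refine transMatrix_windowOf_pos hR hp e fun x h0 h1 => ?_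
    exact Equiv.swap_apply_of_ne_of_ne (fun h => h0 (by rw [h])) (fun h => h1 (by rw [h]))
  have h := ((reachable_rotation_pow hR hp j).mul hp h1).mul hp
    (reachable_rotation_pow hR hp (M - 1 - j))
  have hs : Equiv.swap ((j : ZMod M), b) ((j : ZMod M) + 1, b') =
      blockRotation M B ^ j * (Equiv.swap ((0 : ZMod M), b) (1, b') * blockRotation M B) *
        blockRotation M B ^ (M - 1 - j) := by
    have h0 : ((j : ZMod M), b) = (blockRotation M B ^ j) (0, b) := by
      simp [blockRotation_pow_apply]
    have h1 : ((j : ZMod M) + 1, b') = (blockRotation M B ^ j) (1, b') := by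
      simp [blockRotation_pow_apply, add_comm]
    rw [h0, h1, Equiv.swap_apply_apply, mul_assoc, mul_assoc, mul_assoc]
    congr 2
    rw [inv_eq_iff_mul_eq_one, ← pow_succ', ← pow_add, ← blockRotation_pow_card]
    congr 1
    omega
  rw [hs]
  convert h using 1
  omega

/-- Rearrangements that can be achieved in a number of steps divisible by `M`. -/
def reachableSubmonoid : Submonoid (Equiv.Perm (ZMod M × Fin B)) where
  carrier := {g | ∃ k, Reachable R p (by omega : R ≤ M) (M * k) g}
  one_mem' := ⟨0, reachable_rotation_pow hR hp 0⟩
  mul_mem' := by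
    rintro g h ⟨k, hk⟩ ⟨l, hl⟩
    exact ⟨k + l, by rw [mul_add]; exact hk.mul hp hl⟩

/-- Transpositions between neighbouring blocks connect all places of the cycle, so by induction they
yield every transposition with `(0, 0)`, hence all transpositions. A submonoid suffices because the
group is finite and generated by involutions. -/
lemma reachableSubmonoid_eq_top :
    (reachableSubmonoid hR hp : Submonoid (Equiv.Perm (ZMod M × Fin B))) = ⊤ := by
  classical
  have : NeZero M := ⟨by omega⟩
  set H : Submonoid (Equiv.Perm (ZMod M × Fin B)) := reachableSubmonoid hR hp
  have hadj : ∀ (j : ZMod M) (b b' : Fin B), Equiv.swap (j, b) (j + 1, b') ∈ H := fun j b b' => by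
    have h := reachable_swap hR hp (ZMod.val_lt j) b b'
    rw [ZMod.natCast_zmod_val] at h
    exact ⟨1, by rwa [mul_one]⟩
  have hbase : ∀ (j : ℕ) (b : Fin B), Equiv.swap ((0 : ZMod M), (0 : Fin B)) ((j : ZMod M), b) ∈ H := by
    intro j
    induction j with
    | zero =>
      intro b
      refine SubmonoidClass.swap_mem_trans H (hadj 0 0 0) ?_
      rw [Equiv.swap_comm, Nat.cast_zero]
      exact hadj 0 b 0
    | succ j ih =>
      intro b
      refine SubmonoidClass.swap_mem_trans H (ih 0) ?_
      rw [Nat.cast_succ]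
      exact hadj _ _ _
  have hbase' : ∀ x : ZMod M × Fin B, Equiv.swap ((0 : ZMod M), (0 : Fin B)) x ∈ H := fun x => by
    have := hbase x.1.val x.2
    rwa [ZMod.natCast_zmod_val] at this
  rw [eq_top_iff, ← Equiv.Perm.mclosure_isSwap, Submonoid.closure_le]
  rintro _ ⟨x, y, -, rfl⟩
  refine SubmonoidClass.swap_mem_trans H ?_ (hbase' y)
  rw [Equiv.swap_comm]
  exact hbase' x

include hR hp in
/-- Some power of the transition matrix is entrywise positive. -/
theorem exists_transMatrix_pow_pos (hN : N = M * B) :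
    ∃ n, 0 < n ∧ ∀ y y', 0 < (transMatrix (B := B) R p ^ n) y y' := by
  classical
  have : NeZero M := ⟨by omega⟩
  have hex : ∀ g : Equiv.Perm (ZMod M × Fin B), ∃ k, Reachable R p (by omega : R ≤ M) (M * k) g :=
    fun g => by
      have : g ∈ reachableSubmonoid hR hp := by
        rw [reachableSubmonoid_eq_top]; exact Submonoid.mem_top g
      exact this
  choose k hk using hex
  -- One exponent must serve all pairs of windows. It exceeds each `M * k g` by a multiple of `M`,
  -- and the missing steps are filled with full turns, which change nothing.
  refine ⟨M * (∑ g, k g + 1), Nat.mul_pos (by omega) (by omega), fun y y' => ?_⟩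
  obtain ⟨e, rfl⟩ := exists_windowOf_eq hN (by omega : R ≤ M) y
  obtain ⟨e', rfl⟩ := exists_windowOf_eq hN (by omega : R ≤ M) y'
  set g : Equiv.Perm (ZMod M × Fin B) := e'.trans e.symm
  have hle : k g ≤ ∑ g, k g := Finset.single_le_sum (fun _ _ => Nat.zero_le _) (Finset.mem_univ g)
  have h := (hk g).mul hp (reachable_rotation_pow hR hp (M * (∑ g, k g + 1 - k g)))
  rw [pow_mul, blockRotation_pow_card, one_pow, mul_one, ← mul_add,
    Nat.add_sub_cancel' (by omega)] at h
  have := h e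
  rwa [show g.trans e = e' by ext x; simp [g]] at this

include hR hp in
theorem existsUnique_isStationary_transMatrix (hN : N = M * B) :
    ∃! ζ : State N B R → ℝ, IsStationary (transMatrix R p) ζ := by
  have : NeZero M := ⟨by omega⟩
  obtain ⟨n, hn, hpos⟩ := exists_transMatrix_pow_pos hR hp hN
  let e : Arrangement N M B := Fintype.equivOfCardEq (by simp [ZMod.card, hN])
  exact existsUnique_isStationary_of_column (transMatrix_mem_rowStochastic hN (by omega) hp) hn
    fun y => hpos y (windowOf (by omega) e)

include hR hp in
theorem tendsto_transMatrix_pow (hN : N = M * B) {ζ : State N B R → ℝ}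
    (hζ : IsStationary (transMatrix R p) ζ) (y y' : State N B R) :
    Tendsto (fun t : ℕ => (transMatrix R p ^ t) y y') atTop (𝓝 (ζ y')) := by
  obtain ⟨n, hn, hpos⟩ := exists_transMatrix_pow_pos hR hp hN
  exact tendsto_pow_of_column (transMatrix_mem_rowStochastic hN (by omega) hp) hn
    (fun x => hpos x y') hζ.sum_eq_one hζ.stationary y y'

include hR hp in
/-- The chain cannot mix before the initial window has been forgotten. -/
theorem le_of_tvDist_pow_le (hN : N = M * B) {ζ : State N B R → ℝ} {l : ℕ}
    (hl : ∀ y, tvDist ((transMatrix R p ^ l) y) ζ ≤ 1 / 4) : R ≤ l := by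
  by_contra hlt
  have : NeZero M := ⟨by omega⟩
  have hst := pow_mem (transMatrix_mem_rowStochastic (R := R) hN (by omega) hp) l
  let e : Arrangement N M B := Fintype.equivOfCardEq (by simp [ZMod.card, hN])
  -- Two windows that differ in every place. After `l < R` steps the oldest batch still comes from
  -- the start, so the two laws have disjoint supports; their `ℓ¹` distances to `ζ` add up to at
  -- least `2`, while the assumption allows at most `1`.
  set y := windowOf (by omega : R ≤ M) e
  set z := windowOf (by omega : R ≤ M) ((blockRotation M B).trans e)
  have hyz : ∀ k, y.1 k ≠ z.1 k := fun k h => by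
    have h := DFunLike.congr_fun h 0
    simp only [y, z, windowOf_apply, Equiv.trans_apply, blockRotation_apply] at h
    have h1 := congrArg Prod.fst (e.injective h)
    have : (1 : ZMod M) = 0 := by linear_combination -h1
    have h2 : ((1 : ℕ) : ZMod M) = 0 := by exact_mod_cast this
    rw [ZMod.natCast_eq_zero_iff, Nat.dvd_one] at h2
    omega
  set P := transMatrix R p ^ l
  have hdisj : ∀ x, P y x + P z x ≤ |P y x - ζ x| + |P z x - ζ x| := fun x => by
    have h0 : P y x = 0 ∨ P z x = 0 := by
      by_contra! hne
      have hk : l ≤ R - 1 := by omega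
      exact hyz _ ((eq_of_transMatrix_pow_ne_zero hne.1 ⟨R - 1, by omega⟩ hk).symm.trans
        (eq_of_transMatrix_pow_ne_zero hne.2 ⟨R - 1, by omega⟩ hk))
    have h3 : 0 ≤ P y x := nonneg_of_mem_rowStochastic hst
    have h4 : 0 ≤ P z x := nonneg_of_mem_rowStochastic hst
    rcases h0 with h0 | h0 <;> rw [h0] <;>
      cases abs_cases (P y x - ζ x) <;> cases abs_cases (P z x - ζ x) <;>
      cases abs_cases (0 - ζ x) <;> linarith
  have hsum := Finset.sum_le_sum fun x (_ : x ∈ Finset.univ) => hdisj x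
  rw [Finset.sum_add_distrib, Finset.sum_add_distrib, sum_row_of_mem_rowStochastic hst,
    sum_row_of_mem_rowStochastic hst] at hsum
  have h1 := hl y
  have h2 := hl z
  unfold tvDist at h1 h2
  linarith

end Ergodicity

/-! ### The sampled process: finite paths, Markov property, decoupling from the past -/

section SampledBatches

open Matrix

variable {N M B R : ℕ}

instance : DiscreteMeasurableSpace (Fin B ↪ Fin N) := ⟨fun _ => trivial⟩

/-- Extension of a finite path to an infinite one. -/
def extendPath (x₀ : Batch N B) {t : ℕ} (w : Fin t → Batch N B) : ℕ → Batch N B :=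
  fun s => if h : s < t then w ⟨s, h⟩ else x₀

lemma extendPath_apply (x₀ : Batch N B) {t : ℕ} (w : Fin t → Batch N B) {s : ℕ} (h : s < t) :
    extendPath x₀ w s = w ⟨s, h⟩ := dif_pos h

lemma apply_extendPath {β : Type*} {t : ℕ} {Φ : (ℕ → Batch N B) → β}
    (hΦ : DependsOn Φ (Set.Iio t)) (x₀ : Batch N B) (x : ℕ → Batch N B) :
    Φ (extendPath x₀ fun k : Fin t => x k) = Φ x :=
  hΦ fun s hs => by rw [extendPath_apply _ _ hs]

/-- Such a function factors through the finite set of paths of length `t`. Consequently no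
regularity of the losses is needed for measurability or integrability of the iterates. -/
lemma measurable_of_dependsOn {t : ℕ} {Φ : (ℕ → Batch N B) → ℝ} (hΦ : DependsOn Φ (Set.Iio t)) :
    Measurable Φ := by
  rcases isEmpty_or_nonempty (Batch N B) with h | ⟨⟨x₀⟩⟩
  · have : IsEmpty (ℕ → Batch N B) := ⟨fun x => h.elim (x 0)⟩
    exact measurable_of_empty _
  · have : Φ = (fun w : Fin t → Batch N B => Φ (extendPath x₀ w)) ∘ fun x k => x k :=
      funext fun x => (apply_extendPath hΦ x₀ x).symm
    rw [this]
    exact (measurable_of_finite _).comp (measurable_pi_lambda _ fun k => measurable_pi_apply _)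

variable {Ω : Type*} [MeasurableSpace Ω] {μ : Measure Ω} {X : ℕ → Ω → Batch N B}

lemma integrable_of_dependsOn [IsFiniteMeasure μ] (hX : ∀ t, Measurable (X t)) {t : ℕ}
    {Φ : (ℕ → Batch N B) → ℝ} (hΦ : DependsOn Φ (Set.Iio t)) :
    Integrable (fun ω => Φ fun s => X s ω) μ := by
  rcases isEmpty_or_nonempty Ω with h | ⟨⟨ω₀⟩⟩
  · rw [show μ = 0 from Measure.eq_zero_of_isEmpty μ]; exact integrable_zero_measure
  · have hm : Measurable fun ω => fun k : Fin t => X k ω := measurable_pi_lambda _ fun k => hX k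
    have := (Integrable.of_finite (μ := μ.map fun ω => fun k : Fin t => X k ω)
      (f := fun w => Φ (extendPath (X 0 ω₀) w))).comp_measurable hm
    refine this.congr (ae_of_all _ fun ω => ?_)
    exact apply_extendPath hΦ (X 0 ω₀) fun s => X s ω

lemma integral_of_dependsOn [IsFiniteMeasure μ] (hX : ∀ t, Measurable (X t)) {t : ℕ}
    {Φ : (ℕ → Batch N B) → ℝ} (hΦ : DependsOn Φ (Set.Iio t)) (x₀ : Batch N B) :
    ∫ ω, Φ (fun s => X s ω) ∂μ =
      ∑ w : Fin t → Batch N B, μ.real {ω | ∀ s, s < t → X s ω = extendPath x₀ w s} *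
        Φ (extendPath x₀ w) := by
  have hm : Measurable fun ω => fun k : Fin t => X k ω := measurable_pi_lambda _ fun k => hX k
  calc ∫ ω, Φ (fun s => X s ω) ∂μ
      = ∫ ω, Φ (extendPath x₀ fun k : Fin t => X k ω) ∂μ := by
        congr 1; ext ω; exact (apply_extendPath hΦ x₀ fun s => X s ω).symm
    _ = ∫ w, Φ (extendPath x₀ w) ∂(μ.map fun ω => fun k : Fin t => X k ω) :=
        (integral_map hm.aemeasurable
          (measurable_of_finite fun w => Φ (extendPath x₀ w)).aestronglyMeasurable).symm
    _ = _ := by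
        rw [integral_fintype Integrable.of_finite]
        refine Finset.sum_congr rfl fun w _ => ?_
        rw [map_measureReal_apply hm (measurableSet_singleton _), smul_eq_mul]
        congr 2
        ext ω
        simp only [Set.mem_preimage, Set.mem_singleton_iff, Set.mem_ofPred_eq, funext_iff]
        exact ⟨fun h s hs => by rw [extendPath_apply _ _ hs, ← h ⟨s, hs⟩],
          fun h k => by rw [h k k.2, extendPath_apply]⟩

/-- The window of the `R` batches sampled before round `t`, the most recent one first. -/
def windowAt (R t : ℕ) (x : ℕ → Batch N B) : Fin R → Batch N B := fun k => x (t - 1 - k)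

lemma windowAt_dependsOn {t : ℕ} (ht : R ≤ t) :
    DependsOn (windowAt R t : (ℕ → Batch N B) → _) (Set.Iio t) := fun x y h =>
  funext fun k => h _ (Set.mem_Iio.2 (by omega))

lemma push_windowAt {t : ℕ} (x : ℕ → Batch N B) :
    push (x t) (windowAt R t x) = windowAt R (t + 1) x := by
  funext k
  unfold push windowAt
  split_ifs with h
  · simp [h]
  · simp only; congr 1; omega

variable {p : Fin N → ℝ} [IsProbabilityMeasure μ] (hX : IsParticipation R p μ X)

include hX

/-- Markov property: the batch of round `t` can be integrated out. -/
lemma integral_next {t : ℕ} (ht : R ≤ t) {Φ : (ℕ → Batch N B) → Batch N B → ℝ}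
    (hΦ : ∀ J, DependsOn (fun x => Φ x J) (Set.Iio t)) :
    ∫ ω, Φ (fun s => X s ω) (X t ω) ∂μ =
      ∫ ω, ∑ J, transProb p (windowAt R t fun s => X s ω) J * Φ (fun s => X s ω) J ∂μ := by
  classical
  obtain ⟨ω₀⟩ : Nonempty Ω := μ.nonempty_of_neZero
  have hdep : ∀ J, DependsOn (fun x => transProb p (windowAt R t x) J * Φ x J) (Set.Iio t) :=
    fun J x y h => by
      simp only; rw [windowAt_dependsOn ht h, show Φ x J = Φ y J from hΦ J h]
  have hmJ : ∀ J, MeasurableSet {ω | X t ω = J} := fun J =>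
    hX.measurable t (measurableSet_singleton J)
  rw [integral_finsetSum _ fun J _ => integrable_of_dependsOn hX.measurable (hdep J)]
  have h1 : ∀ ω, Φ (fun s => X s ω) (X t ω) =
      ∑ J, {ω | X t ω = J}.indicator (fun ω => Φ (fun s => X s ω) J) ω := fun ω => by
    rw [Finset.sum_eq_single (X t ω)]
    · simp
    · intro J _ hJ; exact Set.indicator_of_notMem (fun h => hJ (by simpa using h.symm)) _
    · exact fun h => absurd (Finset.mem_univ _) h
  simp only [h1]
  rw [integral_finsetSum _ fun J _ =>
    (integrable_of_dependsOn hX.measurable (hΦ J)).indicator (hmJ J)]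
  refine Finset.sum_congr rfl fun J _ => ?_
  rw [integral_indicator (hmJ J), integral_of_dependsOn hX.measurable (hΦ J) (X 0 ω₀),
    integral_of_dependsOn hX.measurable (hdep J) (X 0 ω₀)]
  refine Finset.sum_congr rfl fun w _ => ?_
  rw [measureReal_restrict_apply' (hmJ J), ← mul_assoc]
  congr 1
  -- The Markov hypothesis for the path `w` followed by `J`. The values after round `t` are
  -- irrelevant, which is why the filler `X 0 ω₀` is harmless.
  have hm := hX.markov t ht (Function.update (extendPath (X 0 ω₀) w) t J)
  have hupd : ∀ s, s < t → Function.update (extendPath (X 0 ω₀) w) t J s =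
      extendPath (X 0 ω₀) w s := fun s hs => Function.update_of_ne hs.ne _ _
  have e1 : {ω | ∀ s, s ≤ t → X s ω = Function.update (extendPath (X 0 ω₀) w) t J s} =
      {ω | ∀ s, s < t → X s ω = extendPath (X 0 ω₀) w s} ∩ {ω | X t ω = J} := by
    ext ω
    constructor
    · intro h
      exact ⟨fun s hs => by rw [h s hs.le, hupd s hs], by simpa using h t le_rfl⟩
    · rintro ⟨h, hJ⟩ s hs
      rcases hs.lt_or_eq with hs | rfl
      · rw [h s hs, hupd s hs]
      · rw [Function.update_self]; exact hJ
  have e2 : {ω | ∀ s, s < t → X s ω = Function.update (extendPath (X 0 ω₀) w) t J s} =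
      {ω | ∀ s, s < t → X s ω = extendPath (X 0 ω₀) w s} := by
    ext ω
    exact forall₂_congr fun s hs => by rw [hupd s hs]
  rw [e1, e2, Function.update_self] at hm
  rw [hm]
  congr 2
  exact windowAt_dependsOn ht fun s hs => hupd s hs

lemma ae_nonrepeated_windowAt {t : ℕ} (ht : R ≤ t) :
    ∀ᵐ ω ∂μ, Nonrepeated (windowAt R t fun s => X s ω) := by
  classical
  induction t, ht using Nat.le_induction with
  | base =>
    filter_upwards [hX.initial] with ω hω k l hkl a b
    -- The window lists the initial batches in reversed order.
    exact hω ⟨R - 1 - k, by omega⟩ ⟨R - 1 - l, by omega⟩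
      (fun h => hkl (Fin.ext (by simp only [Fin.mk.injEq] at h; omega))) a b
  | succ t ht ih =>
    -- Indicator that a batch of probability zero is drawn. Its expectation vanishes by the Markov
    -- property, so almost surely the drawn batch is disjoint from the window.
    let Φ : (ℕ → Batch N B) → Batch N B → ℝ := fun x J =>
      if transProb p (windowAt R t x) J = 0 then 1 else 0
    have hΦ : ∀ J, DependsOn (fun x => Φ x J) (Set.Iio t) := fun J x y h => by
      simp only [Φ]; rw [windowAt_dependsOn ht h]
    have hΦ' : DependsOn (fun x => Φ x (x t)) (Set.Iio (t + 1)) := fun x y h => by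
      simp only
      rw [show x t = y t from h t (Set.mem_Iio.2 (by omega))]
      exact hΦ (y t) fun s hs => h s (Set.mem_Iio.2 (by have := Set.mem_Iio.1 hs; omega))
    have h0 : ∫ ω, Φ (fun s => X s ω) (X t ω) ∂μ = 0 := by
      rw [integral_next hX ht hΦ]
      refine integral_eq_zero_of_ae (ae_of_all _ fun ω => Finset.sum_eq_zero fun J _ => ?_)
      by_cases h : transProb p (windowAt R t fun s => X s ω) J = 0 <;> simp [Φ, h]
    rw [integral_eq_zero_iff_of_nonneg (fun ω => by simp only [Φ]; split_ifs <;> simp)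
      (integrable_of_dependsOn hX.measurable hΦ')] at h0
    filter_upwards [h0] with ω hω
    rw [← push_windowAt]
    have hne : transProb p (windowAt R t fun s => X s ω) (X t ω) ≠ 0 := fun h => by
      simp [Φ, h] at hω
    have := not_not.1 fun h => hne (transProb_eq_zero h)
    exact nonrepeated_push this.1 this.2

/-- The transition operator on functions of the window. -/
noncomputable def stepOp (p : Fin N → ℝ) (g : (Fin R → Batch N B) → ℝ) : (Fin R → Batch N B) → ℝ :=
  fun y => ∑ J, transProb p y J * g (push J y)

omit hX [IsProbabilityMeasure μ] in
lemma stepOp_iterate (g : (Fin R → Batch N B) → ℝ) (j : ℕ) (y : State N B R) :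
    (stepOp p)^[j] g y.1 = ∑ y', (transMatrix R p ^ j) y y' * g y'.1 := by
  induction j generalizing g with
  | zero => simp [Matrix.one_apply]
  | succ j ih =>
    rw [Function.iterate_succ_apply, ih]
    simp only [stepOp, ← sum_transMatrix_mul, pow_succ, Matrix.mul_apply, Finset.mul_sum,
      Finset.sum_mul]
    rw [Finset.sum_comm]
    simp only [mul_assoc]

/-- Peeling off the newest batch turns one round into one application of `stepOp`. The first
argument of `Φ` depends only on rounds before `u` and is frozen throughout. -/
lemma integral_windowAt_add {u : ℕ} (hu : R ≤ u) (j : ℕ)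
    {Φ : (ℕ → Batch N B) → (Fin R → Batch N B) → ℝ}
    (hΦ : DependsOn Φ (Set.Iio u)) :
    ∫ ω, Φ (fun s => X s ω) (windowAt R (u + j) fun s => X s ω) ∂μ =
      ∫ ω, (stepOp p)^[j] (Φ fun s => X s ω) (windowAt R u fun s => X s ω) ∂μ := by
  induction j generalizing Φ with
  | zero => rfl
  | succ j ih =>
    have h1 := integral_next hX (t := u + j) (by omega)
      (Φ := fun x J => Φ x (push J (windowAt R (u + j) x))) fun J x y h => by
        simp only
        rw [windowAt_dependsOn (by omega) h,
          hΦ fun s hs => h s (Set.mem_Iio.2 (by have := Set.mem_Iio.1 hs; omega))]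
    have h2 := ih (Φ := fun x => stepOp p (Φ x)) fun x y h => by simp only; rw [hΦ h]
    have h3 : ∀ ω, push (X (u + j) ω) (windowAt R (u + j) fun s => X s ω) =
        windowAt R (u + j + 1) fun s => X s ω := fun ω => push_windowAt fun s => X s ω
    simp only [h3] at h1
    rw [← add_assoc]
    simp only [Function.iterate_succ_apply]
    rw [← h2]
    exact h1

/-- Law of the next batch when the window is stationary. -/
noncomputable def batchDist (p : Fin N → ℝ) (ζ : State N B R → ℝ) (J : Batch N B) : ℝ :=
  ∑ y, ζ y * transProb p y.1 J

/-- After `j` rounds the law of the next batch is close to the stationary one, given the past. -/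
lemma abs_integral_next_sub_le [NeZero B] (hp : IsAvailability p) {u j : ℕ} (hu : R ≤ u)
    (hst : ∀ y : State N B R, ∃ J : Batch N B, Available y.1 J)
    {ζ : State N B R → ℝ} {ε W : ℝ} (hW : 0 ≤ W)
    (hε : ∀ y, ∑ y', |(transMatrix R p ^ j) y y' - ζ y'| ≤ ε)
    {h : (ℕ → Batch N B) → Batch N B → ℝ} (hh : DependsOn h (Set.Iio u))
    (hb : ∀ x J, |h x J| ≤ W) :
    |∫ ω, h (fun s => X s ω) (X (u + j) ω) ∂μ -
        ∫ ω, ∑ J, batchDist p ζ J * h (fun s => X s ω) J ∂μ| ≤ W * ε := by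
  let g : (ℕ → Batch N B) → (Fin R → Batch N B) → ℝ := fun x y => ∑ J, transProb p y J * h x J
  have hg : DependsOn g (Set.Iio u) := fun x y hxy => by simp only [g]; rw [hh hxy]
  -- First the batch of round `u + j` is integrated out, then the `j` preceding ones, leaving a
  -- function of the window at round `u`. There the rows of the `j`-th power of the transition
  -- matrix can be compared with `ζ`.
  have h1 : ∫ ω, h (fun s => X s ω) (X (u + j) ω) ∂μ =
      ∫ ω, (stepOp p)^[j] (g fun s => X s ω) (windowAt R u fun s => X s ω) ∂μ := by
    rw [← integral_windowAt_add hX hu j hg]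
    exact integral_next hX (by omega) fun J x y hxy => by
      simp only
      rw [hh fun s hs => hxy s (Set.mem_Iio.2 (by have := Set.mem_Iio.1 hs; omega))]
  have hgb : ∀ x (y : State N B R), |g x y.1| ≤ W := fun x y => by
    calc |g x y.1| ≤ ∑ J, transProb p y.1 J * W := by
          refine (Finset.abs_sum_le_sum_abs _ _).trans (Finset.sum_le_sum fun J _ => ?_)
          rw [abs_mul, abs_of_nonneg (transProb_nonneg hp _ _)]
          exact mul_le_mul_of_nonneg_left (hb x J) (transProb_nonneg hp _ _)
      _ = W := by rw [← Finset.sum_mul, sum_transProb hp y.2 (hst y), one_mul]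
  have h2 : ∀ x, ∑ J, batchDist p ζ J * h x J = ∑ y, ζ y * g x y.1 := fun x => by
    simp only [batchDist, g, Finset.sum_mul, Finset.mul_sum]
    rw [Finset.sum_comm]
    simp only [mul_assoc]
  simp only [h1, h2]
  rw [← integral_sub]
  · rw [← Real.norm_eq_abs]
    refine (norm_integral_le_of_norm_le_const (μ := μ) (C := W * ε) ?_).trans_eq
      (by rw [probReal_univ, mul_one])
    filter_upwards [ae_nonrepeated_windowAt hX hu] with ω hω
    rw [stepOp_iterate (g _) j ⟨_, hω⟩, ← Finset.sum_sub_distrib, Real.norm_eq_abs]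
    calc _ ≤ ∑ y', |(transMatrix R p ^ j) ⟨_, hω⟩ y' - ζ y'| * W := by
          refine (Finset.abs_sum_le_sum_abs _ _).trans (Finset.sum_le_sum fun y' _ => ?_)
          rw [← sub_mul, abs_mul]
          exact mul_le_mul_of_nonneg_left (hgb _ _) (abs_nonneg _)
      _ ≤ W * ε := by
          rw [← Finset.sum_mul, mul_comm]
          exact mul_le_mul_of_nonneg_left (hε _) hW
  · exact integrable_of_dependsOn hX.measurable
      (Φ := fun x => (stepOp p)^[j] (g x) (windowAt R u x)) (t := u) fun x y hxy => by
        simp only; rw [hg hxy, windowAt_dependsOn hu hxy]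
  · exact integrable_of_dependsOn hX.measurable
      (Φ := fun x => ∑ y, ζ y * g x y.1) (t := u) fun x y hxy => by
        simp only; rw [hg hxy]

-- Splitting according to the value of `I` makes the integrand a product of a function of `I` and a
-- function of finitely many batches, to which independence applies.
omit hX in
lemma integral_uniformIndex (hXm : ∀ t, Measurable (X t)) {T : ℕ} {I : Ω → Fin T}
    (hI : IsUniformIndex μ X I) {Φ : ℕ → (ℕ → Batch N B) → ℝ}
    (hΦ : ∀ t, DependsOn (Φ t) (Set.Iio t)) :
    ∫ ω, Φ (I ω) (fun s => X s ω) ∂μ =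
      (1 / (T : ℝ)) * ∑ t ∈ Finset.range T, ∫ ω, Φ t (fun s => X s ω) ∂μ := by
  classical
  have h1 : ∀ ω, Φ (I ω) (fun s => X s ω) =
      ∑ i : Fin T, (if I ω = i then 1 else 0) * Φ i (fun s => X s ω) := fun ω => by simp
  have hXX : Measurable fun ω => fun t => X t ω := measurable_pi_lambda _ hXm
  have hmi : ∀ i : Fin T, Measurable fun k : Fin T => if k = i then (1 : ℝ) else 0 :=
    fun i => measurable_of_finite _
  have hset : ∀ i, MeasurableSet {ω | I ω = i} := fun i =>
    hI.measurable (measurableSet_singleton i)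
  have hint : ∀ i : Fin T, ∫ ω, (if I ω = i then 1 else 0) * Φ i (fun s => X s ω) ∂μ =
      (1 / (T : ℝ)) * ∫ ω, Φ i (fun s => X s ω) ∂μ := fun i => by
    have hind := hI.indep.comp (hmi i) (measurable_of_dependsOn (hΦ i))
    have := hind.integral_mul_eq_mul_integral ((hmi i).comp hI.measurable).aestronglyMeasurable
      ((measurable_of_dependsOn (hΦ i)).comp hXX).aestronglyMeasurable
    simp only [Pi.mul_apply, Function.comp_apply] at this
    rw [this]
    congr 1
    rw [← hI.uniform i, ← integral_indicator_one (hset i)]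
    congr 1
    ext ω
    simp [Set.indicator_apply]
  simp only [h1]
  rw [integral_finsetSum, Finset.mul_sum, Finset.sum_range fun t =>
    1 / (T : ℝ) * ∫ ω, Φ t (fun s => X s ω) ∂μ]
  · exact Finset.sum_congr rfl fun i _ => hint i
  · intro i _
    have h := (integrable_of_dependsOn (μ := μ) hXm (hΦ i)).indicator (hset i)
    refine h.congr (ae_of_all _ fun ω => ?_)
    simp [Set.indicator_apply]

end SampledBatches

/-! ### Exchangeability within a batch -/

section Symmetry

variable {N B R : ℕ}

lemma batchWeight_trans (p : Fin N → ℝ) (σ : Equiv.Perm (Fin B)) (J : Batch N B) :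
    batchWeight p (σ.toEmbedding.trans J) = batchWeight p J :=
  Equiv.sum_comp σ fun a => p (J a)

lemma transProb_trans (p : Fin N → ℝ) (y : Fin R → Batch N B) (σ : Equiv.Perm (Fin B))
    (J : Batch N B) : transProb p y (σ.toEmbedding.trans J) = transProb p y J := by
  have : Available y (σ.toEmbedding.trans J) ↔ Available y J :=
    ⟨fun h a k b => by simpa using h (σ.symm a) k b, fun h a k b => h (σ a) k b⟩
  unfold transProb
  rw [batchWeight_trans]
  by_cases h : Nonrepeated y ∧ Available y J
  · rw [if_pos h, if_pos ⟨h.1, this.2 h.2⟩]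
  · rw [if_neg h, if_neg fun h' => h ⟨h'.1, this.1 h'.2⟩]

/-- The weight of a batch ignores its order, so swapping entries `0` and `a` preserves the law.
Hence each entry has the law of the first one, which is `π_R`. -/
lemma sum_batchDist_mul [NeZero B] (p : Fin N → ℝ) (ζ : State N B R → ℝ) (φ : Fin N → ℝ)
    (a : Fin B) :
    ∑ J, batchDist p ζ J * φ (J a) = ∑ i, clientDist R p ζ i * φ i := by
  classical
  have hsym : ∑ J, batchDist p ζ J * φ (J a) = ∑ J, batchDist p ζ J * φ (J 0) := by
    let σ : Equiv.Perm (Fin B) := Equiv.swap 0 a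
    let e : Batch N B ≃ Batch N B := Equiv.embeddingCongr σ (Equiv.refl _)
    have he : ∀ J, e J = σ.toEmbedding.trans J := fun J => by
      ext b; simp [e, σ, Equiv.embeddingCongr]
    rw [← Equiv.sum_comp e]
    refine Finset.sum_congr rfl fun J _ => ?_
    rw [he]
    simp only [batchDist, transProb_trans]
    simp [σ]
  rw [hsym]
  simp only [clientDist, Matrix.vecMul, dotProduct, clientMatrix, batchDist, Finset.sum_mul,
    Finset.mul_sum]
  calc ∑ J, ∑ y, ζ y * transProb p y.1 J * φ (J 0)
      = ∑ J, ∑ y, ∑ i, ζ y * (if J 0 = i then transProb p y.1 J else 0) * φ i := by simp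
    _ = ∑ J, ∑ i, ∑ y, ζ y * (if J 0 = i then transProb p y.1 J else 0) * φ i :=
        Finset.sum_congr rfl fun J _ => Finset.sum_comm
    _ = ∑ i, ∑ J, ∑ y, ζ y * (if J 0 = i then transProb p y.1 J else 0) * φ i :=
        Finset.sum_comm
    _ = _ := Finset.sum_congr rfl fun i _ => Finset.sum_comm

end Symmetry

/-! ### Pathwise estimates for FedAvg -/

section Deterministic

variable {E : Type*} [NormedAddCommGroup E] [InnerProductSpace ℝ E]

lemma norm_average_le {B : ℕ} [NeZero B] {v : Fin B → E} {c : ℝ} (h : ∀ a, ‖v a‖ ≤ c) :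
    ‖(1 / (B : ℝ)) • ∑ a, v a‖ ≤ c := by
  have hB : (0 : ℝ) < B := Nat.cast_pos.2 (NeZero.pos B)
  rw [norm_smul, Real.norm_of_nonneg (by positivity), one_div, inv_mul_le_iff₀ hB]
  refine (norm_sum_le _ _).trans ((Finset.sum_le_sum fun a _ => h a).trans_eq ?_)
  simp

lemma average_const {B : ℕ} [NeZero B] (v : E) : (1 / (B : ℝ)) • ∑ _a : Fin B, v = v := by
  have hB : (B : ℝ) ≠ 0 := Nat.cast_ne_zero.2 (NeZero.ne B)
  rw [Finset.sum_const, Finset.card_univ, Fintype.card_fin, ← Nat.cast_smul_eq_nsmul ℝ, smul_smul,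
    one_div, inv_mul_cancel₀ hB, one_smul]

variable [CompleteSpace E]

lemma hasGradientAt_globalObj {N : ℕ} {f : Fin N → E → ℝ} {g : Fin N → E} {x : E}
    (hf : ∀ i, HasGradientAt (f i) (g i) x) :
    HasGradientAt (globalObj f) ((1 / (N : ℝ)) • ∑ i, g i) x := by
  have h := (HasFDerivAt.fun_sum (u := Finset.univ) fun i _ => (hf i).hasFDerivAt).const_mul
    (1 / (N : ℝ))
  have e : InnerProductSpace.toDual ℝ E ((1 / (N : ℝ)) • ∑ i, g i) =
      (1 / (N : ℝ)) • ∑ i, InnerProductSpace.toDual ℝ E (g i) := by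
    rw [map_smulₛₗ, map_sum]
    simp
  rw [hasGradientAt_iff_hasFDerivAt, e]
  exact h

namespace IsRegular

variable {N : ℕ} {f : Fin N → E → ℝ} {L G D : ℝ} (h : IsRegular f L G D)

include h

lemma gradient_globalObj (x : E) :
    gradient (globalObj f) x = (1 / (N : ℝ)) • ∑ i, gradient (f i) x :=
  (hasGradientAt_globalObj fun i => (h.differentiable i x).hasGradientAt).gradient

lemma differentiable_globalObj : Differentiable ℝ (globalObj f) := fun x =>
  (hasGradientAt_globalObj fun i =>
    (h.differentiable i x).hasGradientAt).hasFDerivAt.differentiableAt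

lemma smooth_globalObj [NeZero N] (x y : E) :
    ‖gradient (globalObj f) x - gradient (globalObj f) y‖ ≤ L * ‖x - y‖ := by
  rw [h.gradient_globalObj, h.gradient_globalObj, ← smul_sub, ← Finset.sum_sub_distrib]
  exact norm_average_le fun i => h.smooth i x y

lemma norm_hetero (hG : 0 ≤ G) (i : Fin N) (x : E) :
    ‖gradient (f i) x - gradient (globalObj f) x‖ ≤ G :=
  le_of_sq_le_sq (h.hetero i x) hG

lemma norm_gradient_le (hG : 0 ≤ G) (i : Fin N) (x : E) : ‖gradient (f i) x‖ ≤ G + D := by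
  have := norm_add_le (gradient (f i) x - gradient (globalObj f) x) (gradient (globalObj f) x)
  rw [sub_add_cancel] at this
  linarith [h.norm_hetero hG i x, h.gradBound x]

/-- Descent inequality for the global objective. -/
lemma globalObj_le [NeZero N] (hL : 0 ≤ L) (x y : E) :
    globalObj f y ≤ globalObj f x + inner ℝ (gradient (globalObj f) x) (y - x)
      + L * ‖y - x‖ ^ 2 := by
  -- The mean value theorem gives the quadratic term with `L` in place of the sharp `L / 2`, which
  -- is enough here.
  obtain ⟨z, hz, hzy⟩ := domain_mvt (s := Set.univ) (x := x) (y := y)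
    (fun z _ => ((h.differentiable_globalObj z).hasGradientAt.hasFDerivAt).hasFDerivWithinAt)
    convex_univ (Set.mem_univ _) (Set.mem_univ _)
  rw [InnerProductSpace.toDual_apply_apply] at hzy
  have hzx : ‖z - x‖ ≤ ‖y - x‖ := by
    obtain ⟨t, ht, rfl⟩ := (segment_eq_image' ℝ x y ▸ hz : z ∈ (fun θ : ℝ => x + θ • (y - x)) '' _)
    simp only [add_sub_cancel_left, norm_smul, Real.norm_of_nonneg ht.1]
    exact mul_le_of_le_one_left (norm_nonneg _) ht.2
  have h1 : inner ℝ (gradient (globalObj f) z - gradient (globalObj f) x) (y - x) ≤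
      L * ‖y - x‖ ^ 2 := by
    refine (real_inner_le_norm _ _).trans ?_
    calc _ ≤ L * ‖y - x‖ * ‖y - x‖ := by
          gcongr
          exact (h.smooth_globalObj z x).trans (by gcongr)
      _ = _ := by ring
  rw [inner_sub_left] at h1
  linarith

/-- The gradient in the stationary client distribution `q`, compared with the global gradient. -/
lemma inner_weighted_gradient_ge (hG : 0 ≤ G) {q : Fin N → ℝ} (hq : ∑ i, q i = 1) [NeZero N]
    (x : E) :
    1 / 2 * ‖gradient (globalObj f) x‖ ^ 2 - 1 / 2 * G ^ 2 * biasL1 q ^ 2 ≤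
      ∑ i, q i * inner ℝ (gradient (globalObj f) x) (gradient (f i) x) := by
  set v := gradient (globalObj f) x
  have hN : (N : ℝ) ≠ 0 := Nat.cast_ne_zero.2 (NeZero.ne N)
  have hsum : ∑ i : Fin N, (q i - 1 / (N : ℝ)) = 0 := by
    rw [Finset.sum_sub_distrib, hq]; simp [hN]
  have havg : ∑ i : Fin N, (1 / (N : ℝ)) * inner ℝ v (gradient (f i) x) = ‖v‖ ^ 2 := by
    rw [← real_inner_self_eq_norm_sq, ← Finset.mul_sum, ← inner_sum, ← real_inner_smul_right,
      ← h.gradient_globalObj]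
  -- The weights `q i - 1 / N` sum to zero, so `v` may be subtracted from each gradient; only the
  -- heterogeneity, bounded by `G`, multiplies the bias.
  have h1 : ∑ i, q i * inner ℝ v (gradient (f i) x) =
      ‖v‖ ^ 2 + ∑ i, (q i - 1 / (N : ℝ)) * inner ℝ v (gradient (f i) x - v) := by
    have : ∀ i, (q i - 1 / (N : ℝ)) * inner ℝ v (gradient (f i) x - v) =
        q i * inner ℝ v (gradient (f i) x) - (1 / (N : ℝ)) * inner ℝ v (gradient (f i) x) -
          (q i - 1 / (N : ℝ)) * inner ℝ v v := fun i => by rw [inner_sub_right]; ring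
    simp only [this, Finset.sum_sub_distrib, havg, ← Finset.sum_mul, hsum]
    ring
  have h2 : |∑ i, (q i - 1 / (N : ℝ)) * inner ℝ v (gradient (f i) x - v)| ≤
      biasL1 q * (‖v‖ * G) := by
    rw [biasL1, Finset.sum_mul]
    refine (Finset.abs_sum_le_sum_abs _ _).trans (Finset.sum_le_sum fun i _ => ?_)
    rw [abs_mul]
    gcongr
    exact (abs_real_inner_le_norm _ _).trans (by gcongr; exact h.norm_hetero hG i x)
  have h3 := neg_le_of_abs_le h2
  rw [h1]
  nlinarith [sq_nonneg (‖v‖ - G * biasL1 q)]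

end IsRegular

section LocalSteps

variable {g : E → ℝ} {L H α : ℝ} (hL : 0 ≤ L) (hα : 0 ≤ α)
  (hb : ∀ x, ‖gradient g x‖ ≤ H) (hs : ∀ x y, ‖gradient g x - gradient g y‖ ≤ L * ‖x - y‖)

lemma localSteps_succ (g : E → ℝ) (α : ℝ) (k : ℕ) (x : E) :
    localSteps g α (k + 1) x = localSteps g α k x - α • gradient g (localSteps g α k x) := by
  unfold localSteps
  rw [Function.iterate_succ_apply']

include hα hb in
lemma norm_localSteps_sub_le (k : ℕ) (x : E) : ‖localSteps g α k x - x‖ ≤ α * k * H := by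
  induction k with
  | zero => simp [localSteps]
  | succ k ih =>
    rw [localSteps_succ, sub_right_comm]
    refine (norm_sub_le _ _).trans ?_
    rw [norm_smul, Real.norm_of_nonneg hα]
    have := mul_le_mul_of_nonneg_left (hb (localSteps g α k x)) hα
    push_cast
    linarith

include hL hα hb hs in
lemma norm_localSteps_sub_add_le (k : ℕ) (x : E) :
    ‖localSteps g α k x - x + (α * k) • gradient g x‖ ≤ (α * k) ^ 2 * L * H := by
  have hH : 0 ≤ H := (norm_nonneg _).trans (hb x)
  induction k with
  | zero => simp [localSteps]
  | succ k ih =>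
    have e : localSteps g α (k + 1) x - x + (α * (k + 1 : ℕ)) • gradient g x =
        (localSteps g α k x - x + (α * k) • gradient g x) -
          α • (gradient g (localSteps g α k x) - gradient g x) := by
      rw [localSteps_succ]; push_cast; module
    rw [e]
    refine (norm_sub_le _ _).trans ?_
    rw [norm_smul, Real.norm_of_nonneg hα]
    have h1 : α * ‖gradient g (localSteps g α k x) - gradient g x‖ ≤ α * (L * (α * k * H)) := by
      gcongr
      exact (hs _ _).trans (by gcongr; exact norm_localSteps_sub_le hα hb k x)
    -- The slack in the induction, as `k ^ 2 + k + (k + 1) = (k + 1) ^ 2`.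
    have h2 : 0 ≤ α ^ 2 * L * H * (k + 1) := by positivity
    push_cast
    nlinarith

end LocalSteps

section Server

variable {N B : ℕ}

/-- Average of the gradients of the clients of a batch. -/
noncomputable def batchGradient (f : Fin N → E → ℝ) (J : Batch N B) (x : E) : E :=
  (1 / (B : ℝ)) • ∑ a, gradient (f (J a)) x

lemma fedAvg_dependsOn (f : Fin N → E → ℝ) (α : ℝ) (K : ℕ) (x₀ : E) (t : ℕ) :
    DependsOn (fun S : ℕ → Batch N B => fedAvg f α K x₀ S t) (Set.Iio t) := by
  induction t with
  | zero => intro x y _; rfl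
  | succ t ih =>
    intro x y hxy
    simp only [fedAvg]
    rw [hxy t (Set.mem_Iio.2 (Nat.lt_succ_self t)),
      show fedAvg f α K x₀ x t = fedAvg f α K x₀ y t from
        ih fun s hs => hxy s (Set.mem_Iio.2 (Nat.lt_succ_of_lt hs))]

lemma fedAvg_congr (f : Fin N → E → ℝ) (α : ℝ) (K : ℕ) (x₀ : E) {t : ℕ} {S S' : ℕ → Batch N B}
    (h : ∀ s ∈ Set.Iio t, S s = S' s) : fedAvg f α K x₀ S t = fedAvg f α K x₀ S' t :=
  fedAvg_dependsOn f α K x₀ t h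

variable {f : Fin N → E → ℝ} {L G D α : ℝ} {K : ℕ} [NeZero B] (h : IsRegular f L G D)
  (hL : 0 ≤ L) (hG : 0 ≤ G) (hα : 0 ≤ α) (x₀ : E) (S : ℕ → Batch N B)

include h hG in
lemma norm_batchGradient_le (J : Batch N B) (x : E) : ‖batchGradient f J x‖ ≤ G + D :=
  norm_average_le fun a => h.norm_gradient_le hG (J a) x

include h in
lemma norm_batchGradient_sub_le (J : Batch N B) (x y : E) :
    ‖batchGradient f J x - batchGradient f J y‖ ≤ L * ‖x - y‖ := by
  rw [batchGradient, batchGradient, ← smul_sub, ← Finset.sum_sub_distrib]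
  exact norm_average_le fun a => h.smooth (J a) x y

include h hG hα in
lemma norm_fedAvg_succ_sub_le (t : ℕ) :
    ‖fedAvg f α K x₀ S (t + 1) - fedAvg f α K x₀ S t‖ ≤ α * K * (G + D) := by
  set x := fedAvg f α K x₀ S t with hx
  have e : fedAvg f α K x₀ S (t + 1) - x =
      (1 / (B : ℝ)) • ∑ a, (localSteps (f (S t a)) α K x - x) := by
    rw [Finset.sum_sub_distrib, smul_sub, average_const]
    rfl
  rw [e]
  exact norm_average_le fun a => norm_localSteps_sub_le hα (h.norm_gradient_le hG _) K x

include h hG hα in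
lemma norm_fedAvg_add_sub_le (t s : ℕ) :
    ‖fedAvg f α K x₀ S (t + s) - fedAvg f α K x₀ S t‖ ≤ s * (α * K) * (G + D) := by
  induction s with
  | zero => simp
  | succ s ih =>
    have := norm_add_le (fedAvg f α K x₀ S (t + s + 1) - fedAvg f α K x₀ S (t + s))
      (fedAvg f α K x₀ S (t + s) - fedAvg f α K x₀ S t)
    rw [sub_add_sub_cancel] at this
    have h1 := norm_fedAvg_succ_sub_le (K := K) h hG hα x₀ S (t + s)
    rw [← add_assoc]
    push_cast
    linarith

include h hL hG hα in
lemma norm_fedAvg_succ_error_le (t : ℕ) :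
    ‖fedAvg f α K x₀ S (t + 1) - fedAvg f α K x₀ S t +
      (α * K) • batchGradient f (S t) (fedAvg f α K x₀ S t)‖ ≤ (α * K) ^ 2 * L * (G + D) := by
  set x := fedAvg f α K x₀ S t with hx
  have e : fedAvg f α K x₀ S (t + 1) - x + (α * K) • batchGradient f (S t) x =
      (1 / (B : ℝ)) • ∑ a,
        (localSteps (f (S t a)) α K x - x + (α * K) • gradient (f (S t a)) x) := by
    rw [Finset.sum_add_distrib, Finset.sum_sub_distrib, smul_add, smul_sub, average_const,
      ← Finset.smul_sum, smul_comm]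
    rfl
  rw [e]
  exact norm_average_le fun a => norm_localSteps_sub_add_le hL hα (h.norm_gradient_le hG _)
    (h.smooth _) K x

include h hL hG hα in
/-- One round of FedAvg decreases the objective up to a second order error. -/
lemma globalObj_fedAvg_succ_le [NeZero N] (hD : 0 ≤ D) (t : ℕ) :
    globalObj f (fedAvg f α K x₀ S (t + 1)) ≤ globalObj f (fedAvg f α K x₀ S t) -
      α * K * inner ℝ (gradient (globalObj f) (fedAvg f α K x₀ S t))
        (batchGradient f (S t) (fedAvg f α K x₀ S t)) +
      (α * K) ^ 2 * (2 * L * (G + D) ^ 2) := by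
  have h1 := h.globalObj_le hL (fedAvg f α K x₀ S t) (fedAvg f α K x₀ S (t + 1))
  have h2 := norm_fedAvg_succ_sub_le (K := K) h hG hα x₀ S t
  have h3 := norm_fedAvg_succ_error_le (K := K) h hL hG hα x₀ S t
  set x := fedAvg f α K x₀ S t
  set x' := fedAvg f α K x₀ S (t + 1)
  have h4 : inner ℝ (gradient (globalObj f) x) (x' - x + (α * K) • batchGradient f (S t) x) ≤
      (G + D) * ((α * K) ^ 2 * L * (G + D)) := by
    refine (real_inner_le_norm _ _).trans ?_
    gcongr
    linarith [h.gradBound x]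
  rw [inner_add_right, real_inner_smul_right] at h4
  have h5 : L * ‖x' - x‖ ^ 2 ≤ L * (α * K * (G + D)) ^ 2 := by gcongr
  nlinarith

include h hL hG in
lemma inner_batchGradient_sub_le [NeZero N] (hD : 0 ≤ D) (J : Batch N B) (x y : E) :
    inner ℝ (gradient (globalObj f) y) (batchGradient f J y) ≤
      inner ℝ (gradient (globalObj f) x) (batchGradient f J x) + 2 * L * (G + D) * ‖x - y‖ := by
  have e : inner ℝ (gradient (globalObj f) y) (batchGradient f J y) -
      inner ℝ (gradient (globalObj f) x) (batchGradient f J x) =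
      inner ℝ (gradient (globalObj f) y - gradient (globalObj f) x) (batchGradient f J y) +
      inner ℝ (gradient (globalObj f) x) (batchGradient f J y - batchGradient f J x) := by
    rw [inner_sub_left, inner_sub_right]; ring
  have h1 : inner ℝ (gradient (globalObj f) y - gradient (globalObj f) x) (batchGradient f J y) ≤
      L * ‖x - y‖ * (G + D) := by
    refine (real_inner_le_norm _ _).trans ?_
    gcongr
    · rw [norm_sub_rev x y]; exact h.smooth_globalObj y x
    · exact norm_batchGradient_le h hG J y
  have h2 : inner ℝ (gradient (globalObj f) x) (batchGradient f J y - batchGradient f J x) ≤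
      (G + D) * (L * ‖x - y‖) := by
    refine (real_inner_le_norm _ _).trans ?_
    gcongr
    · linarith [h.gradBound x]
    · rw [norm_sub_rev x y]; exact norm_batchGradient_sub_le h J y x
  linarith

omit [NeZero B] in
include h hL hG in
lemma sq_norm_gradient_sub_le [NeZero N] (x y : E) :
    ‖gradient (globalObj f) x‖ ^ 2 ≤
      ‖gradient (globalObj f) y‖ ^ 2 + 2 * L * (G + D) * ‖x - y‖ := by
  have h1 := h.smooth_globalObj x y
  have h2 := norm_le_insert' (gradient (globalObj f) x) (gradient (globalObj f) y)
  have h3 := h.gradBound x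
  have h4 := h.gradBound y
  have h5 : (‖gradient (globalObj f) x‖ - ‖gradient (globalObj f) y‖) *
      (‖gradient (globalObj f) x‖ + ‖gradient (globalObj f) y‖) ≤
      (L * ‖x - y‖) * (2 * (G + D)) := by
    refine mul_le_mul (by linarith) (by linarith) (by positivity) (by positivity)
  nlinarith

include h hG in
lemma abs_inner_batchGradient_le (hD : 0 ≤ D) (J : Batch N B) (x : E) :
    |inner ℝ (gradient (globalObj f) x) (batchGradient f J x)| ≤ (G + D) ^ 2 := by
  refine (abs_real_inner_le_norm _ _).trans ?_
  rw [sq]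
  gcongr
  · linarith [h.gradBound x]
  · exact norm_batchGradient_le h hG J x

lemma sum_batchDist_inner {R : ℕ} (p : Fin N → ℝ) (ζ : State N B R → ℝ) (f : Fin N → E → ℝ)
    (v x : E) :
    ∑ J, batchDist p ζ J * inner ℝ v (batchGradient f J x) =
      ∑ i, clientDist R p ζ i * inner ℝ v (gradient (f i) x) := by
  have hB : (B : ℝ) ≠ 0 := Nat.cast_ne_zero.2 (NeZero.ne B)
  have h1 : ∀ J : Batch N B, batchDist p ζ J * inner ℝ v (batchGradient f J x) =
      (1 / (B : ℝ)) * ∑ a, batchDist p ζ J * inner ℝ v (gradient (f (J a)) x) := fun J => by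
    rw [batchGradient, real_inner_smul_right, inner_sum, ← Finset.mul_sum]; ring
  simp only [h1]
  rw [← Finset.mul_sum, Finset.sum_comm]
  simp only [sum_batchDist_mul p ζ fun i => inner ℝ v (gradient (f i) x)]
  rw [Finset.sum_const, Finset.card_univ, Fintype.card_fin, nsmul_eq_mul, ← mul_assoc, one_div,
    inv_mul_cancel₀ hB, one_mul]

end Server

end Deterministic

/-! ### Expected descent and the convergence bound -/

section Bound

variable {N M B R : ℕ} [NeZero B] {p : Fin N → ℝ} {ζ : State N B R → ℝ}

lemma sum_clientDist (hN : N = M * B) (hR : R + 1 ≤ M) (hp : IsAvailability p)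
    (hζ : ∑ y, ζ y = 1) : ∑ i, clientDist R p ζ i = 1 := by
  have : NeZero M := ⟨by omega⟩
  have h := sum_batchDist_mul p ζ (fun _ => 1) 0
  simp only [mul_one] at h
  rw [← h]
  simp only [batchDist]
  rw [Finset.sum_comm]
  simp only [← Finset.mul_sum]
  rw [← hζ]
  exact Finset.sum_congr rfl fun y _ => by
    rw [sum_transProb hp y.2 (exists_available hN hR y), mul_one]

variable {E : Type*} [NormedAddCommGroup E] [InnerProductSpace ℝ E] [CompleteSpace E]
  {f : Fin N → E → ℝ} {L G D α : ℝ} {K : ℕ} (h : IsRegular f L G D)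
  (hL : 0 ≤ L) (hG : 0 ≤ G) (hD : 0 ≤ D) (hα : 0 ≤ α) (x₀ : E)
  {Ω : Type*} [MeasurableSpace Ω] {μ : Measure Ω} [IsProbabilityMeasure μ]
  {X : ℕ → Ω → Batch N B}

omit [NeZero B] in
lemma integrable_fedAvg (hX : ∀ t, Measurable (X t)) (t : ℕ) (φ : E → ℝ) :
    Integrable (fun ω => φ (fedAvg f α K x₀ (fun s => X s ω) t)) μ :=
  integrable_of_dependsOn hX (Φ := fun S => φ (fedAvg f α K x₀ S t)) (t := t) fun x y hxy => by
    simp only; rw [fedAvg_congr f α K x₀ hxy]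

omit [NeZero B] in
lemma integrable_fedAvg_next (hX : ∀ t, Measurable (X t)) (u t : ℕ) (φ : E → Batch N B → ℝ) :
    Integrable (fun ω => φ (fedAvg f α K x₀ (fun s => X s ω) u) (X t ω)) μ :=
  integrable_of_dependsOn hX (Φ := fun S => φ (fedAvg f α K x₀ S u) (S t)) (t := max u (t + 1))
    fun x y hxy => by
      simp only
      rw [hxy t (Set.mem_Iio.2 (by omega)), fedAvg_congr f α K x₀ fun s hs =>
        hxy s (Set.mem_Iio.2 (by have := Set.mem_Iio.1 hs; omega))]

include h hL hG hD hα in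
/-- Descent in expectation for a round in which the window has had time to mix. -/
lemma expected_descent (hN : N = M * B) (hR : R + 1 ≤ M) (hp : IsAvailability p)
    (hζ : ∑ y, ζ y = 1) (hX : IsParticipation R p μ X) {u s : ℕ} (hu : R ≤ u) {ε : ℝ}
    (hε : ∀ y, ∑ y', |(transMatrix R p ^ s) y y' - ζ y'| ≤ ε) :
    α * K * (1 / 2 * ∫ ω, ‖gradient (globalObj f) (fedAvg f α K x₀ (fun s => X s ω) (u + s))‖ ^ 2 ∂μ)
      ≤ (∫ ω, globalObj f (fedAvg f α K x₀ (fun s => X s ω) (u + s)) ∂μ) -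
        (∫ ω, globalObj f (fedAvg f α K x₀ (fun s => X s ω) (u + s + 1)) ∂μ) +
        α * K * (1 / 2 * G ^ 2 * biasL1 (clientDist R p ζ) ^ 2 + (G + D) ^ 2 * ε +
          3 * L * (G + D) ^ 2 * (s * (α * K)) + 2 * L * (G + D) ^ 2 * (α * K)) := by
  have : NeZero M := ⟨by omega⟩
  have : NeZero N := ⟨by rw [hN]; exact mul_ne_zero (NeZero.ne M) (NeZero.ne B)⟩
  set H := G + D with hH
  set η := α * K with hη
  have hη0 : 0 ≤ η := by positivity
  have hH0 : 0 ≤ H := by positivity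
  set b := biasL1 (clientDist R p ζ) with hb
  let x : ℕ → Ω → E := fun t ω => fedAvg f α K x₀ (fun s => X s ω) t
  let v : E → Batch N B → ℝ := fun z J =>
    inner ℝ (gradient (globalObj f) z) (batchGradient f J z)
  have hmeas := hX.measurable
  have hdist : ∀ ω, ‖x u ω - x (u + s) ω‖ ≤ s * η * H := fun ω => by
    rw [norm_sub_rev]; exact norm_fedAvg_add_sub_le h hG hα x₀ _ u s
  have hint : ∀ t (φ : E → ℝ), Integrable (fun ω => φ (x t ω)) μ :=
    fun t φ => integrable_fedAvg x₀ hmeas t φ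
  have hint' : ∀ t t' (φ : E → Batch N B → ℝ), Integrable (fun ω => φ (x t ω) (X t' ω)) μ :=
    fun t t' φ => integrable_fedAvg_next x₀ hmeas t t' φ
  have h1 : (∫ ω, globalObj f (x (u + s + 1) ω) ∂μ) ≤ (∫ ω, globalObj f (x (u + s) ω) ∂μ) -
      η * (∫ ω, v (x (u + s) ω) (X (u + s) ω) ∂μ) + η ^ 2 * (2 * L * H ^ 2) := by
    have hi : Integrable (fun ω => globalObj f (x (u + s) ω) -
        η * v (x (u + s) ω) (X (u + s) ω)) μ := (hint _ _).sub ((hint' _ _ v).const_mul η)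
    have := integral_mono (hint (u + s + 1) (globalObj f))
      (hi.add (integrable_const (η ^ 2 * (2 * L * H ^ 2)))) fun ω =>
        globalObj_fedAvg_succ_le (K := K) h hL hG hα x₀ (fun s => X s ω) hD (u + s)
    refine this.trans_eq ?_
    simp only [Pi.add_apply]
    rw [integral_add hi (integrable_const _), integral_sub (hint _ _)
      ((hint' _ _ v).const_mul η), integral_const_mul, integral_const, probReal_univ, one_smul]
  -- The iterate is moved back to round `u`, where it is a function of the batches before `u`; only
  -- then can the batch of round `u + s` be decoupled from it.
  have h2 : (∫ ω, v (x u ω) (X (u + s) ω) ∂μ) - 2 * L * H * (s * η * H) ≤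
      ∫ ω, v (x (u + s) ω) (X (u + s) ω) ∂μ := by
    have hi := (hint' u (u + s) v).sub (integrable_const (2 * L * H * (s * η * H)))
    have := integral_mono hi (hint' (u + s) (u + s) v) fun ω => by
      have h3 := inner_batchGradient_sub_le h hL hG hD (X (u + s) ω) (x (u + s) ω) (x u ω)
      have h4 : 2 * L * H * ‖x (u + s) ω - x u ω‖ ≤ 2 * L * H * (s * η * H) := by
        rw [norm_sub_rev]; gcongr; exact hdist ω
      simp only [Pi.sub_apply, v]
      linarith
    refine le_trans (le_of_eq ?_) this
    simp only [Pi.sub_apply]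
    rw [integral_sub (hint' _ _ v) (integrable_const _), integral_const, probReal_univ, one_smul]
  have h3 : (∫ ω, ∑ J, batchDist p ζ J * v (x u ω) J ∂μ) - H ^ 2 * ε ≤
      ∫ ω, v (x u ω) (X (u + s) ω) ∂μ := by
    have := abs_integral_next_sub_le hX hp hu (exists_available hN hR) (W := H ^ 2) (by positivity)
      hε (h := fun S J => v (fedAvg f α K x₀ S u) J)
      (fun S S' hS => by simp only; rw [fedAvg_congr f α K x₀ hS])
      fun S J => abs_inner_batchGradient_le h hG hD J _
    have := neg_le_of_abs_le this
    linarith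
  have h4 : 1 / 2 * (∫ ω, ‖gradient (globalObj f) (x u ω)‖ ^ 2 ∂μ) - 1 / 2 * G ^ 2 * b ^ 2 ≤
      ∫ ω, ∑ J, batchDist p ζ J * v (x u ω) J ∂μ := by
    have hq := sum_clientDist hN hR hp hζ
    have hi := ((hint u fun z => ‖gradient (globalObj f) z‖ ^ 2).const_mul (1 / 2)).sub
      (integrable_const (1 / 2 * G ^ 2 * b ^ 2))
    have := integral_mono hi (hint u fun z => ∑ J, batchDist p ζ J * v z J) fun ω => by
      simp only [Pi.sub_apply, v]
      rw [sum_batchDist_inner]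
      exact h.inner_weighted_gradient_ge hG hq (x u ω)
    refine le_trans (le_of_eq ?_) this
    simp only [Pi.sub_apply]
    rw [integral_sub ((hint u fun z => ‖gradient (globalObj f) z‖ ^ 2).const_mul _)
      (integrable_const _), integral_const_mul, integral_const, probReal_univ, one_smul]
  -- Return from round `u` to round `u + s`. Half of this error and the error of `h2` add up to the
  -- coefficient `3 * L`.
  have h5 : (∫ ω, ‖gradient (globalObj f) (x (u + s) ω)‖ ^ 2 ∂μ) ≤
      (∫ ω, ‖gradient (globalObj f) (x u ω)‖ ^ 2 ∂μ) + 2 * L * H * (s * η * H) := by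
    have hi := (hint u fun z => ‖gradient (globalObj f) z‖ ^ 2).add
      (integrable_const (2 * L * H * (s * η * H)))
    have := integral_mono (hint (u + s) fun z => ‖gradient (globalObj f) z‖ ^ 2) hi fun ω => by
      have h3 := sq_norm_gradient_sub_le h hL hG (x (u + s) ω) (x u ω)
      have h4 : 2 * L * H * ‖x (u + s) ω - x u ω‖ ≤ 2 * L * H * (s * η * H) := by
        rw [norm_sub_rev]; gcongr; exact hdist ω
      simp only [Pi.add_apply]
      linarith
    refine this.trans_eq ?_
    simp only [Pi.add_apply]
    rw [integral_add (hint u fun z => ‖gradient (globalObj f) z‖ ^ 2) (integrable_const _),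
      integral_const, probReal_univ, one_smul]
  have h6 : 1 / 2 * (∫ ω, ‖gradient (globalObj f) (x (u + s) ω)‖ ^ 2 ∂μ) ≤
      (∫ ω, v (x (u + s) ω) (X (u + s) ω) ∂μ) + (1 / 2 * G ^ 2 * b ^ 2 + H ^ 2 * ε +
        3 * L * H ^ 2 * (s * η)) := by linarith
  have h7 := mul_le_mul_of_nonneg_left h6 hη0
  linarith

include h hL hG hD hα in
/-- Bound for the change of the objective in an arbitrary round. -/
lemma expected_descent_crude [NeZero N] (hX : ∀ t, Measurable (X t)) (t : ℕ) :
    α * K * (1 / 2 * ∫ ω, ‖gradient (globalObj f) (fedAvg f α K x₀ (fun s => X s ω) t)‖ ^ 2 ∂μ)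
      ≤ (∫ ω, globalObj f (fedAvg f α K x₀ (fun s => X s ω) t) ∂μ) -
        (∫ ω, globalObj f (fedAvg f α K x₀ (fun s => X s ω) (t + 1)) ∂μ) +
        α * K * (3 / 2 * (G + D) ^ 2 + 2 * L * (G + D) ^ 2 * (α * K)) := by
  have hη0 : 0 ≤ α * K := by positivity
  have hint : ∀ t (φ : E → ℝ), Integrable
      (fun ω => φ (fedAvg f α K x₀ (fun s => X s ω) t)) μ :=
    fun t φ => integrable_fedAvg x₀ hX t φ
  have hi : Integrable (fun ω => globalObj f (fedAvg f α K x₀ (fun s => X s ω) t) -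
      globalObj f (fedAvg f α K x₀ (fun s => X s ω) (t + 1))) μ :=
    (hint t (globalObj f)).sub (hint (t + 1) (globalObj f))
  have := integral_mono ((hint t fun z => ‖gradient (globalObj f) z‖ ^ 2).const_mul
    (α * K * (1 / 2))) (hi.add (integrable_const
      (α * K * (3 / 2 * (G + D) ^ 2 + 2 * L * (G + D) ^ 2 * (α * K))))) fun ω => by
    have h1 := globalObj_fedAvg_succ_le (K := K) h hL hG hα x₀ (fun s => X s ω) hD t
    have h2 := neg_le_of_abs_le (abs_inner_batchGradient_le h hG hD (X t ω)
      (fedAvg f α K x₀ (fun s => X s ω) t))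
    have h3 := h.gradBound (fedAvg f α K x₀ (fun s => X s ω) t)
    have h4 : ‖gradient (globalObj f) (fedAvg f α K x₀ (fun s => X s ω) t)‖ ^ 2 ≤ (G + D) ^ 2 := by
      gcongr; linarith
    simp only [Pi.add_apply]
    have h5 := mul_le_mul_of_nonneg_left h4 hη0
    have h6 := mul_le_mul_of_nonneg_left h2 hη0
    linarith
  rw [← mul_assoc, ← integral_const_mul]
  refine this.trans_eq ?_
  simp only [Pi.add_apply]
  rw [integral_add hi (integrable_const _), integral_sub (hint _ _) (hint _ _), integral_const,
    probReal_univ, one_smul]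

include h hL hG hD in
/-- Bound for the averaged squared gradient norm in terms of the stepsize and a number `s` of
rounds after which the chain of windows is within `ε` of stationarity. -/
theorem outputSqGrad_le_of_mixed (hN : N = M * B) (hR : R + 1 ≤ M) (hp : IsAvailability p)
    (hζ : ∑ y, ζ y = 1) (hX : IsParticipation R p μ X) {s T : ℕ} {ε Δ : ℝ}
    (hε : ∀ y, ∑ y', |(transMatrix R p ^ s) y y' - ζ y'| ≤ ε) (hK : 1 ≤ K) (hα' : 0 < α)
    (hT : 1 ≤ T) (hΔ : ∀ x, globalObj f x₀ - globalObj f x ≤ Δ)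
    {I : Ω → Fin T} (hI : IsUniformIndex μ X I) :
    outputSqGrad μ f α K x₀ X I ≤ 2 * Δ / (α * K * T) +
      (G ^ 2 * biasL1 (clientDist R p ζ) ^ 2 + 2 * (G + D) ^ 2 * ε +
        6 * L * (G + D) ^ 2 * (s * (α * K)) + 4 * L * (G + D) ^ 2 * (α * K)) +
      3 * (G + D) ^ 2 * (R + s) / T := by
  have : NeZero M := ⟨by omega⟩
  have : NeZero N := ⟨by rw [hN]; exact mul_ne_zero (NeZero.ne M) (NeZero.ne B)⟩
  have hK0 : (0 : ℝ) < K := by exact_mod_cast hK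
  have hT0 : (0 : ℝ) < T := by exact_mod_cast hT
  have hη : 0 < α * K := mul_pos hα' hK0
  have hε0 : 0 ≤ ε := by
    obtain ⟨y⟩ : Nonempty (State N B R) := by
      by_contra hne
      rw [not_nonempty_iff] at hne
      simp at hζ
    exact (Finset.sum_nonneg fun _ _ => abs_nonneg _).trans (hε y)
  set b := biasL1 (clientDist R p ζ)
  let φ : ℕ → ℝ := fun t =>
    ∫ ω, ‖gradient (globalObj f) (fedAvg f α K x₀ (fun s => X s ω) t)‖ ^ 2 ∂μ
  let F : ℕ → ℝ := fun t => ∫ ω, globalObj f (fedAvg f α K x₀ (fun s => X s ω) t) ∂μ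
  set A := 1 / 2 * G ^ 2 * b ^ 2 + (G + D) ^ 2 * ε + 3 * L * (G + D) ^ 2 * (s * (α * K)) +
    2 * L * (G + D) ^ 2 * (α * K) with hA
  have hstep : ∀ t, α * K * (1 / 2 * φ t) ≤ F t - F (t + 1) +
      α * K * (A + if t < R + s then 3 / 2 * (G + D) ^ 2 else 0) := fun t => by
    -- The first `R + s` rounds use the crude estimate. In a later round `t = u + s` with `R ≤ u`,
    -- so the window at round `u` is governed by the chain.
    split_ifs with ht
    · refine (expected_descent_crude h hL hG hD hα'.le x₀ hX.measurable t).trans ?_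
      have : 3 / 2 * (G + D) ^ 2 + 2 * L * (G + D) ^ 2 * (α * K) ≤ A + 3 / 2 * (G + D) ^ 2 := by
        have : 0 ≤ 1 / 2 * G ^ 2 * b ^ 2 + (G + D) ^ 2 * ε +
          3 * L * (G + D) ^ 2 * (s * (α * K)) := by positivity
        linarith
      simp only [F]
      gcongr
    · obtain ⟨u, rfl⟩ : ∃ u, t = u + s := ⟨t - s, by omega⟩
      rw [add_zero]
      exact expected_descent h hL hG hD hα'.le x₀ hN hR hp hζ hX (by omega) hε
  have hsum := Finset.sum_le_sum fun t (_ : t ∈ Finset.range T) => hstep t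
  rw [Finset.sum_add_distrib, Finset.sum_range_sub', ← Finset.mul_sum, ← Finset.mul_sum,
    ← Finset.mul_sum, Finset.sum_add_distrib, Finset.sum_const, Finset.card_range,
    nsmul_eq_mul] at hsum
  have hind : ∑ t ∈ Finset.range T, (if t < R + s then 3 / 2 * (G + D) ^ 2 else 0) ≤
      (R + s) * (3 / 2 * (G + D) ^ 2) := by
    rw [← Finset.sum_filter, Finset.sum_const, nsmul_eq_mul]
    gcongr
    have : (Finset.range T).filter (fun t => t < R + s) ⊆ Finset.range (R + s) := fun t ht => by
      simp at ht ⊢; exact ht.2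
    have := Finset.card_le_card this
    rw [Finset.card_range] at this
    exact_mod_cast this
  have hF : F 0 - F T ≤ Δ := by
    have hi : Integrable (fun ω => globalObj f (fedAvg f α K x₀ (fun s => X s ω) T)) μ :=
      integrable_fedAvg x₀ hX.measurable T (globalObj f)
    have h1 := integral_mono (integrable_const (globalObj f x₀ - Δ)) hi fun ω => by
      have := hΔ (fedAvg f α K x₀ (fun s => X s ω) T)
      simp only
      linarith
    have h0 : F 0 = globalObj f x₀ := by
      simp only [F, fedAvg, integral_const, probReal_univ, one_smul]
    rw [integral_const, probReal_univ, one_smul] at h1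
    simp only [F] at h0 ⊢
    linarith
  have hout : outputSqGrad μ f α K x₀ X I = 1 / (T : ℝ) * ∑ t ∈ Finset.range T, φ t :=
    integral_uniformIndex hX.measurable hI
      (Φ := fun t S => ‖gradient (globalObj f) (fedAvg f α K x₀ S t)‖ ^ 2)
      fun t S S' hS => by simp only; rw [fedAvg_congr f α K x₀ hS]
  rw [hout]
  have h1 : α * K * (1 / 2 * ∑ t ∈ Finset.range T, φ t) ≤
      Δ + α * K * (T * A + (R + s) * (3 / 2 * (G + D) ^ 2)) := by
    refine hsum.trans (add_le_add hF ?_)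
    gcongr
  have h2 : ∑ t ∈ Finset.range T, φ t ≤
      2 * Δ / (α * K) + 2 * (T * A) + (R + s) * (3 * (G + D) ^ 2) := by
    have : ∑ t ∈ Finset.range T, φ t =
        (α * K * (1 / 2 * ∑ t ∈ Finset.range T, φ t)) * 2 / (α * K) := by
      field_simp
    rw [this, div_le_iff₀ hη]
    have e : (2 * Δ / (α * K) + 2 * (T * A) + (R + s) * (3 * (G + D) ^ 2)) * (α * K) =
        (Δ + α * K * (T * A + (R + s) * (3 / 2 * (G + D) ^ 2))) * 2 := by
      field_simp; ring
    rw [e]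
    exact mul_le_mul_of_nonneg_right h1 zero_le_two
  calc 1 / (T : ℝ) * ∑ t ∈ Finset.range T, φ t ≤
      1 / (T : ℝ) * (2 * Δ / (α * K) + 2 * (T * A) + (R + s) * (3 * (G + D) ^ 2)) := by gcongr
    _ = _ := by rw [hA]; field_simp; ring

end Bound

/-- The convergence bound for FedAvg with all constants explicit. -/
theorem outputSqGrad_le {N M B R K T : ℕ} [NeZero B] {p : Fin N → ℝ} {ζ : State N B R → ℝ}
    {E : Type*} [NormedAddCommGroup E] [InnerProductSpace ℝ E] [CompleteSpace E]
    {f : Fin N → E → ℝ} {x₀ : E} {α L G D Δ c₁ c₂ : ℝ} (hL : 0 < L) (hG : 0 < G) (hD : 0 < D)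
    (hΔ0 : 0 ≤ Δ) (hc₁ : 0 < c₁) (hc : c₁ ≤ c₂)
    (hN : N = M * B) (hR : R + 2 ≤ M) (hK : 1 ≤ K) (hp : IsAvailability p)
    (hζ : IsStationary (transMatrix R p) ζ) (h : IsRegular f L G D)
    (hΔ : ∀ x, globalObj f x₀ - globalObj f x ≤ Δ)
    (hα : StepsizeOrder c₁ c₂ (mixingTime (transMatrix R p) ζ) K T α)
    {Ω : Type*} [MeasurableSpace Ω] {μ : Measure Ω} [IsProbabilityMeasure μ]
    {X : ℕ → Ω → Batch N B} {I : Ω → Fin T} (hX : IsParticipation R p μ X)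
    (hI : IsUniformIndex μ X I) :
    outputSqGrad μ f α K x₀ X I ≤
      (16 * (G + D) ^ 2 + 16 * L * (G + D) ^ 2 * c₂ + 2 * Δ / c₁) *
          ((mixingTime (transMatrix R p) ζ : ℝ) * (1 + Real.log (T : ℝ)) / √(T : ℝ)) +
        (16 * (G + D) ^ 2 + 16 * L * (G + D) ^ 2 * c₂ + 2 * Δ / c₁) / (T : ℝ) +
        1 * (G ^ 2 + D ^ 2) * biasL1 (clientDist R p ζ) ^ 2 := by
  obtain ⟨ω₀⟩ : Nonempty Ω := μ.nonempty_of_neZero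
  have hT : 1 ≤ T := by have := (I ω₀).2; omega
  obtain ⟨hτ1, hτ⟩ := one_le_mixingTime (tendsto_transMatrix_pow hR hp hN hζ)
  set τ := mixingTime (transMatrix R p) ζ with hτdef
  have hRτ : R ≤ τ := le_of_tvDist_pow_le hR hp hN hτ
  -- With this choice `T < 2 ^ k`, so the chain is within `2 / T` of stationarity after `τ * k`
  -- rounds, while `τ * k` is still of order `τ (1 + log T)`.
  set k := Nat.log 2 T + 1 with hk
  have hmix := fun y => sum_abs_pow_mul_sub_le
    (transMatrix_mem_rowStochastic hN (by omega) hp) hζ hτ k y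
  have hK0 : (0 : ℝ) < K := by exact_mod_cast hK
  have hT1 : (1 : ℝ) ≤ T := by exact_mod_cast hT
  have hT0 : (0 : ℝ) < T := by linarith
  have hτ1' : (1 : ℝ) ≤ τ := by exact_mod_cast hτ1
  have hτ0 : (0 : ℝ) < τ := by linarith
  have hsq : 0 < √(T : ℝ) := Real.sqrt_pos.2 hT0
  have hsq1 : 1 ≤ √(T : ℝ) := Real.one_le_sqrt.2 hT1
  have hsqT : √(T : ℝ) * √(T : ℝ) = T := Real.mul_self_sqrt hT0.le
  obtain ⟨hα1, hα2⟩ := hα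
  have hα0 : 0 < α := lt_of_lt_of_le (by positivity) hα1
  have hη1 : c₁ / (τ * √(T : ℝ)) ≤ α * K := by
    calc c₁ / (τ * √(T : ℝ)) = c₁ / (τ * K * √(T : ℝ)) * K := by field_simp
      _ ≤ α * K := by gcongr
  have hη2 : α * K ≤ c₂ / (τ * √(T : ℝ)) := by
    calc α * K ≤ c₂ / (τ * K * √(T : ℝ)) * K := by gcongr
      _ = c₂ / (τ * √(T : ℝ)) := by field_simp
  have hη0 : 0 < α * K := by positivity
  have hc₂ : 0 < c₂ := by linarith
  have hlog : 0 ≤ Real.log T := Real.log_nonneg hT1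
  have hmain := outputSqGrad_le_of_mixed (K := K) h hL.le hG.le hD.le x₀ hN (by omega) hp
    hζ.sum_eq_one hX hmix hK hα0 hT hΔ hI
  set ℓ := 1 + Real.log (T : ℝ) with hℓ
  have hℓ1 : 1 ≤ ℓ := by linarith
  have hkℓ : (k : ℝ) ≤ 2 * ℓ := by
    have h1 : (Nat.log 2 T : ℝ) * Real.log 2 ≤ Real.log T := by
      rw [← Real.log_pow]
      refine Real.log_le_log (by positivity) ?_
      exact_mod_cast Nat.pow_log_le_self 2 (by omega)
    have h2 : (1 / 2 : ℝ) ≤ Real.log 2 := by have := Real.log_two_gt_d9; linarith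
    have h3 : (Nat.log 2 T : ℝ) * (1 / 2) ≤ Real.log T :=
      (mul_le_mul_of_nonneg_left h2 (Nat.cast_nonneg _)).trans h1
    rw [hk, hℓ]
    push_cast
    linarith
  have hεT : 2 * (1 / 2 : ℝ) ^ k ≤ 2 / T := by
    have h1 : (T : ℝ) ≤ 2 ^ k := by exact_mod_cast (Nat.lt_pow_succ_log_self one_lt_two T).le
    rw [div_pow, one_pow, mul_one_div]
    gcongr
  set Q := τ * ℓ / √(T : ℝ) with hQ
  set H := G + D with hH
  have hH0 : 0 < H := by positivity
  have hs : ((τ * k : ℕ) : ℝ) ≤ τ * (2 * ℓ) := by push_cast; gcongr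
  have t1 : 2 * Δ / (α * K * T) ≤ 2 * Δ / c₁ * Q := by
    calc 2 * Δ / (α * K * T) ≤ 2 * Δ / (c₁ / (τ * √(T : ℝ)) * T) := by gcongr
      _ = 2 * Δ / c₁ * (τ * 1 / √(T : ℝ)) := by
        field_simp; rw [Real.sq_sqrt hT0.le]
      _ ≤ 2 * Δ / c₁ * Q := by rw [hQ]; gcongr
  have t2 : 2 * H ^ 2 * (2 * (1 / 2 : ℝ) ^ k) ≤ 4 * H ^ 2 / T := by
    calc _ ≤ 2 * H ^ 2 * (2 / T) := by gcongr
      _ = _ := by ring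
  have t3 : 6 * L * H ^ 2 * (((τ * k : ℕ) : ℝ) * (α * K)) ≤ 12 * L * H ^ 2 * c₂ * Q := by
    calc 6 * L * H ^ 2 * (((τ * k : ℕ) : ℝ) * (α * K))
        ≤ 6 * L * H ^ 2 * ((τ * (2 * ℓ)) * (c₂ / (τ * √(T : ℝ)))) := by gcongr
      _ = 12 * L * H ^ 2 * c₂ * (1 * ℓ / √(T : ℝ)) := by field_simp; ring
      _ ≤ _ := by rw [hQ]; gcongr
  have t4 : 4 * L * H ^ 2 * (α * K) ≤ 4 * L * H ^ 2 * c₂ * Q := by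
    calc 4 * L * H ^ 2 * (α * K) ≤ 4 * L * H ^ 2 * (c₂ / (1 * √(T : ℝ))) := by
          gcongr; exact hη2.trans (by gcongr)
      _ = 4 * L * H ^ 2 * c₂ * (1 * 1 / √(T : ℝ)) := by ring
      _ ≤ _ := by rw [hQ]; gcongr
  have t5 : 3 * H ^ 2 * (R + ((τ * k : ℕ) : ℝ)) / T ≤ 12 * H ^ 2 * Q := by
    -- `R ≤ τ` keeps the burn-in independent of `R`, so the constant depends on the six given
    -- numbers only.
    have hRs : (R : ℝ) ≤ τ * (2 * ℓ) := by
      have : (R : ℝ) ≤ τ := by exact_mod_cast hRτ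
      nlinarith
    calc 3 * H ^ 2 * (R + ((τ * k : ℕ) : ℝ)) / T
        ≤ 3 * H ^ 2 * (τ * (2 * ℓ) + τ * (2 * ℓ)) / (1 * √(T : ℝ)) := by
          gcongr
          calc 1 * √(T : ℝ) ≤ √(T : ℝ) * √(T : ℝ) := by gcongr
            _ = T := hsqT
      _ = _ := by rw [hQ]; ring
  have hQ0 : 0 < Q := by positivity
  have t6 : 0 ≤ (4 * H ^ 2) * Q := by positivity
  have t7 : 4 * H ^ 2 / T ≤ (16 * H ^ 2 + 16 * L * H ^ 2 * c₂ + 2 * Δ / c₁) / T := by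
    gcongr
    have : 0 ≤ 12 * H ^ 2 + 16 * L * H ^ 2 * c₂ + 2 * Δ / c₁ := by positivity
    linarith
  have t8 : 0 ≤ D ^ 2 * biasL1 (clientDist R p ζ) ^ 2 := by positivity
  linarith

/-! ### The three-client example -/

section Example

/-- The location `i ∈ {1, 2, 3}` of the minimizer of the `i`-th example loss. -/
def exampleCenter (i : Fin 3) : ℝ := (i : ℕ) + 1

/-- Transition matrix of the sampled clients in the three-client example. -/
noncomputable def exampleTrans : Matrix (Fin 3) (Fin 3) ℝ :=
  !![0, 1 / 3, 2 / 3; 1 / 3, 0, 2 / 3; 1 / 2, 1 / 2, 0]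

lemma vecCons_three_two (a b c : ℝ) : (![a, b, c] : Fin 3 → ℝ) 2 = c := rfl

lemma exampleAvail_isAvailability : IsAvailability exampleAvail where
  pos i := by fin_cases i <;> norm_num [exampleAvail]
  sum_eq_one := by norm_num [exampleAvail, Fin.sum_univ_three, vecCons_three_two]

/-- A batch of one client is a client. -/
def singleBatchEquiv (N : ℕ) : Batch N 1 ≃ Fin N where
  toFun J := J 0
  invFun i := ⟨fun _ => i, fun _ _ _ => Subsingleton.elim _ _⟩
  left_inv J := DFunLike.ext _ _ fun a => congrArg J (Subsingleton.elim 0 a)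
  right_inv _ := rfl

lemma sum_singleBatch {N : ℕ} (φ : Fin N → ℝ) : ∑ J : Batch N 1, φ (J 0) = ∑ i, φ i :=
  Equiv.sum_comp (singleBatchEquiv N) φ

/-- A window of one batch of one client is a client. -/
def singleStateEquiv (N : ℕ) : State N 1 1 ≃ Fin N where
  toFun y := y.1 0 0
  invFun i := ⟨fun _ => (singleBatchEquiv N).symm i,
    fun k l hkl => absurd (Subsingleton.elim k l) hkl⟩
  left_inv y := Subtype.ext (funext fun k => by
    rw [Subsingleton.elim k 0]; exact (singleBatchEquiv N).symm_apply_apply _)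
  right_inv _ := rfl

lemma transProb_example (y : Fin 1 → Batch 3 1) (J : Batch 3 1) :
    transProb exampleAvail y J = exampleTrans (y 0 0) (J 0) := by
  classical
  have hav : ∀ J : Batch 3 1, Available y J ↔ J 0 ≠ y 0 0 := fun J =>
    ⟨fun h => h 0 0 0, fun h a k b => by
      rw [Subsingleton.elim a 0, Subsingleton.elim k 0, Subsingleton.elim b 0]; exact h⟩
  have hnr : Nonrepeated y := fun k l hkl => absurd (Subsingleton.elim k l) hkl
  have hw : ∀ J : Batch 3 1, batchWeight exampleAvail J = exampleAvail (J 0) := fun J => by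
    simp [batchWeight]
  have hsum : (∑ J' : Batch 3 1, if Available y J' then batchWeight exampleAvail J' else 0) =
      ∑ i, if i ≠ y 0 0 then exampleAvail i else 0 := by
    rw [← sum_singleBatch fun i => if i ≠ y 0 0 then exampleAvail i else 0]
    exact Finset.sum_congr rfl fun J' _ => by simp only [hav, hw]
  have h : transProb exampleAvail y J = if J 0 ≠ y 0 0 then exampleAvail (J 0) /
      (∑ i, if i ≠ y 0 0 then exampleAvail i else 0) else 0 := by
    rw [← hsum, ← hw]
    by_cases hJ : J 0 ≠ y 0 0
    · rw [if_pos hJ, transProb, if_pos ⟨hnr, (hav J).2 hJ⟩]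
    · rw [if_neg hJ, transProb, if_neg fun h => hJ ((hav J).1 h.2)]
  rw [h]
  generalize J 0 = j
  generalize y 0 0 = a
  fin_cases a <;> fin_cases j <;>
    simp [exampleTrans, exampleAvail, Fin.sum_univ_three] <;> norm_num

/-- A window is a single client here, so the chain of windows and the client matrix are both
`exampleTrans`. Thus `π_R` is the stationary law itself, found by solving a linear system. -/
lemma clientDist_example {ζ : State 3 1 1 → ℝ}
    (hζ : IsStationary (transMatrix 1 exampleAvail) ζ) :
    clientDist 1 exampleAvail ζ = ![3 / 10, 3 / 10, 4 / 10] := by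
  classical
  let z : Fin 3 → ℝ := fun i => ζ ((singleStateEquiv 3).symm i)
  have hsum : ∀ g : State 3 1 1 → ℝ, ∑ y, g y = ∑ i, g ((singleStateEquiv 3).symm i) :=
    fun g => (Equiv.sum_comp (singleStateEquiv 3).symm g).symm
  have hst : ∀ i, z i = ∑ a, z a * exampleTrans a i := fun i => by
    have h := congrFun hζ.stationary ((singleStateEquiv 3).symm i)
    rw [Matrix.vecMul, dotProduct, hsum] at h
    rw [show z i = ζ ((singleStateEquiv 3).symm i) from rfl, ← h]
    refine Finset.sum_congr rfl fun a _ => ?_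
    congr 1
    rw [transMatrix, Finset.sum_eq_single ((singleBatchEquiv 3).symm i)]
    · rw [if_pos, transProb_example]
      · rfl
      · funext k
        rw [Subsingleton.elim k 0]
        rfl
    · intro J _ hJ
      refine if_neg fun hp => hJ ?_
      have := congrFun hp 0
      exact this
    · exact fun h => absurd (Finset.mem_univ _) h
  have h1 : ∑ i, z i = 1 := by rw [← hζ.sum_eq_one, hsum]
  have hcd : ∀ i, clientDist 1 exampleAvail ζ i = ∑ a, z a * exampleTrans a i := fun i => by
    rw [clientDist, Matrix.vecMul, dotProduct, hsum]
    refine Finset.sum_congr rfl fun a _ => ?_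
    congr 1
    simp only [clientMatrix, transProb_example]
    rw [sum_singleBatch fun j => if j = i then
      exampleTrans (((singleStateEquiv 3).symm a).1 0 0) j else 0]
    simp
    rfl
  have h0' := hst 0
  have h1' := hst 1
  have h2' := hst 2
  simp [Fin.sum_univ_three, exampleTrans] at h0' h1' h2' h1
  funext i
  rw [hcd, ← hst]
  fin_cases i <;> simp <;> linarith

lemma biasL1_example {ζ : State 3 1 1 → ℝ}
    (hζ : IsStationary (transMatrix 1 exampleAvail) ζ) :
    biasL1 (clientDist 1 exampleAvail ζ) = 2 / 15 := by
  rw [clientDist_example hζ, biasL1, Fin.sum_univ_three]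
  norm_num [abs_of_neg, abs_of_pos, vecCons_three_two]

lemma sum_clientDist_mul_center {ζ : State 3 1 1 → ℝ}
    (hζ : IsStationary (transMatrix 1 exampleAvail) ζ) :
    ∑ i : Fin 3, clientDist 1 exampleAvail ζ i * ((i : ℕ) + 1 : ℝ) = 21 / 10 := by
  rw [clientDist_example hζ, Fin.sum_univ_three]
  norm_num [vecCons_three_two]

variable {Ω : Type*} [MeasurableSpace Ω] {μ : Measure Ω} [IsProbabilityMeasure μ]
  {X : ℕ → Ω → Batch 3 1} (hX : IsParticipation 1 exampleAvail μ X)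

include hX

lemma integrable_client (φ : Fin 3 → ℝ) (t : ℕ) : Integrable (fun ω => φ (X t ω 0)) μ :=
  integrable_of_dependsOn hX.measurable (Φ := fun x => φ (x t 0)) (t := t + 1) fun x y h => by
    simp only; rw [h t (Set.mem_Iio.2 t.lt_succ_self)]

lemma integral_client_succ (φ : Fin 3 → ℝ) (t : ℕ) :
    ∫ ω, φ (X (t + 1) ω 0) ∂μ = ∫ ω, (exampleTrans.mulVec φ) (X t ω 0) ∂μ := by
  have h := integral_next hX (t := t + 1) (by omega) (Φ := fun _ J => φ (J 0))
    fun J x y _ => rfl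
  simp only [transProb_example] at h
  rw [h]
  congr 1
  ext ω
  rw [sum_singleBatch fun j => exampleTrans (windowAt 1 (t + 1) (fun s => X s ω) 0 0) j * φ j]
  rfl

lemma integral_client_of_eigenvector {φ : Fin 3 → ℝ} {c : ℝ}
    (hφ : exampleTrans.mulVec φ = c • φ) (t : ℕ) :
    ∫ ω, φ (X t ω 0) ∂μ = c ^ t * ∫ ω, φ (X 0 ω 0) ∂μ := by
  induction t with
  | zero => simp
  | succ t ih =>
    rw [integral_client_succ hX, hφ]
    simp only [Pi.smul_apply, smul_eq_mul]
    rw [integral_const_mul, ih]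
    ring

/-- The expected label of the sampled client converges geometrically. -/
lemma abs_integral_center_sub_le (t : ℕ) :
    |∫ ω, exampleCenter (X t ω 0) ∂μ - 21 / 10| ≤ 2 * (2 / 3) ^ t := by
  -- The two nonconstant right eigenvectors of `exampleTrans`, with eigenvalues `-2 / 3` and `-1 /
  -- 3`. The center is its stationary mean `21 / 10` plus a combination of them.
  let u : Fin 3 → ℝ := ![-2 / 5, -2 / 5, 3 / 5]
  let w : Fin 3 → ℝ := ![1, -1, 0]
  have hu : exampleTrans.mulVec u = (-2 / 3 : ℝ) • u := by
    funext i
    fin_cases i <;> norm_num [exampleTrans, u, Matrix.mulVec, dotProduct, Fin.sum_univ_three,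
      vecCons_three_two]
  have hw : exampleTrans.mulVec w = (-1 / 3 : ℝ) • w := by
    funext i
    fin_cases i <;> norm_num [exampleTrans, w, Matrix.mulVec, dotProduct, Fin.sum_univ_three,
      vecCons_three_two]
  have hc : ∀ i, exampleCenter i = 21 / 10 + (3 / 2 * u i - 1 / 2 * w i) := fun i => by
    fin_cases i <;> norm_num [exampleCenter, u, w]
  have hub : |∫ ω, u (X 0 ω 0) ∂μ| ≤ 1 := by
    rw [← Real.norm_eq_abs]
    refine (norm_integral_le_of_norm_le_const (μ := μ) (C := 1) (ae_of_all _ fun ω => ?_)).trans_eq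
      (by rw [probReal_univ, mul_one])
    generalize X 0 ω 0 = i
    fin_cases i <;> norm_num [u]
  have hwb : |∫ ω, w (X 0 ω 0) ∂μ| ≤ 1 := by
    rw [← Real.norm_eq_abs]
    refine (norm_integral_le_of_norm_le_const (μ := μ) (C := 1) (ae_of_all _ fun ω => ?_)).trans_eq
      (by rw [probReal_univ, mul_one])
    generalize X 0 ω 0 = i
    fin_cases i <;> norm_num [w]
  have hi : ∫ ω, exampleCenter (X t ω 0) ∂μ - 21 / 10 =
      3 / 2 * ((-2 / 3) ^ t * ∫ ω, u (X 0 ω 0) ∂μ) -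
        1 / 2 * ((-1 / 3) ^ t * ∫ ω, w (X 0 ω 0) ∂μ) := by
    have hd : Integrable (fun ω => 3 / 2 * u (X t ω 0) - 1 / 2 * w (X t ω 0)) μ :=
      ((integrable_client hX u t).const_mul _).sub ((integrable_client hX w t).const_mul _)
    simp only [hc]
    rw [← integral_client_of_eigenvector hX hu, ← integral_client_of_eigenvector hX hw,
      integral_add (integrable_const _) hd,
      integral_sub ((integrable_client hX u t).const_mul _)
        ((integrable_client hX w t).const_mul _), integral_const_mul, integral_const_mul,
      integral_const, probReal_univ, one_smul]
    ring
  have e1 : |(-2 / 3 : ℝ) ^ t * ∫ ω, u (X 0 ω 0) ∂μ| ≤ (2 / 3) ^ t := by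
    rw [abs_mul, abs_pow, show |(-2 / 3 : ℝ)| = 2 / 3 by norm_num [abs_of_neg]]
    exact mul_le_of_le_one_right (by positivity) hub
  have e2 : |(-1 / 3 : ℝ) ^ t * ∫ ω, w (X 0 ω 0) ∂μ| ≤ (2 / 3) ^ t := by
    rw [abs_mul, abs_pow, show |(-1 / 3 : ℝ)| = 1 / 3 by norm_num [abs_of_neg]]
    refine (mul_le_of_le_one_right (by positivity) hwb).trans ?_
    gcongr
    norm_num
  rw [hi]
  rw [abs_le] at e1 e2 ⊢
  constructor <;> linarith

omit hX

lemma hasDerivAt_exampleLoss (i : Fin 3) (x : ℝ) :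
    HasDerivAt (exampleLoss i) (x - exampleCenter i) x := by
  have h := (((hasDerivAt_id x).sub_const (exampleCenter i)).pow 2).const_mul (1 / 2 : ℝ)
  exact h.congr_deriv (by simp)

lemma gradient_exampleLoss (i : Fin 3) (x : ℝ) :
    gradient (exampleLoss i) x = x - exampleCenter i :=
  (hasDerivAt_exampleLoss i x).hasGradientAt'.gradient

/-- Local steps on a function which is quadratic around `c` along the trajectory. -/
lemma localSteps_eq_of_gradient {g : ℝ → ℝ} {c α x : ℝ} {K : ℕ}
    (hg : ∀ k < K, gradient g (c + (1 - α) ^ k * (x - c)) = (1 - α) ^ k * (x - c)) :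
    localSteps g α K x = c + (1 - α) ^ K * (x - c) := by
  induction K with
  | zero => simp [localSteps]
  | succ K ih =>
    rw [localSteps_succ, ih fun k hk => hg k (hk.trans K.lt_succ_self), hg K K.lt_succ_self,
      pow_succ, smul_eq_mul]
    ring

lemma fedAvg_single_succ {N : ℕ} (f : Fin N → ℝ → ℝ) (α : ℝ) (K : ℕ) (x₀ : ℝ)
    (S : ℕ → Batch N 1) (t : ℕ) :
    fedAvg f α K x₀ S (t + 1) = localSteps (f (S t 0)) α K (fedAvg f α K x₀ S t) := by
  simp [fedAvg]

include hX in
/-- Recursion for the expected iterates when every round contracts towards the center. -/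
lemma integral_fedAvg_succ {f : Fin 3 → ℝ → ℝ} {α x₀ ρ : ℝ} {K : ℕ}
    (hf : ∀ (S : ℕ → Batch 3 1) t, fedAvg f α K x₀ S (t + 1) =
      exampleCenter (S t 0) + ρ * (fedAvg f α K x₀ S t - exampleCenter (S t 0))) (t : ℕ) :
    ∫ ω, fedAvg f α K x₀ (fun s => X s ω) (t + 1) ∂μ =
      ρ * ∫ ω, fedAvg f α K x₀ (fun s => X s ω) t ∂μ +
        (1 - ρ) * ∫ ω, exampleCenter (X t ω 0) ∂μ := by
  have h : ∀ ω, fedAvg f α K x₀ (fun s => X s ω) (t + 1) =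
      ρ * fedAvg f α K x₀ (fun s => X s ω) t + (1 - ρ) * exampleCenter (X t ω 0) := fun ω => by
    rw [hf]; ring
  simp only [h]
  rw [integral_add ((integrable_fedAvg (φ := fun x => x) x₀ hX.measurable t).const_mul ρ)
    ((integrable_client hX exampleCenter t).const_mul _), integral_const_mul, integral_const_mul]

lemma tendsto_of_contraction {m b : ℕ → ℝ} {ρ c : ℝ} (hρ : |ρ| < 1)
    (hb : ∀ t, |b t - c| ≤ 2 * (2 / 3) ^ t) (hm : ∀ t, m (t + 1) = ρ * m t + (1 - ρ) * b t) :
    Tendsto m atTop (𝓝 c) := by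
  set r := max |ρ| (2 / 3) with hr
  have hr1 : r < 1 := max_lt hρ (by norm_num)
  have hr0 : 0 < r := lt_of_lt_of_le (by norm_num) (le_max_right _ _)
  -- Bounding both rates by `r` costs the factor `t`. The forcing contributes at most `|1 - ρ| * 2 *
  -- r ^ t ≤ 4 * r ^ t` per step, and `1 / r` accounts for the shift of the exponent.
  have hbound : ∀ t : ℕ, |m t - c| ≤ |m 0 - c| * r ^ t + 4 / r * (t * r ^ t) := fun t => by
    induction t with
    | zero => simp
    | succ t ih =>
      have e : m (t + 1) - c = ρ * (m t - c) + (1 - ρ) * (b t - c) := by rw [hm]; ring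
      have h1 : |ρ * (m t - c)| ≤ r * (|m 0 - c| * r ^ t + 4 / r * (t * r ^ t)) := by
        rw [abs_mul]
        gcongr
        exact le_max_left _ _
      have h2 : |(1 - ρ) * (b t - c)| ≤ 2 * (2 * r ^ t) := by
        rw [abs_mul]
        have h3 := abs_lt.1 hρ
        gcongr
        · rw [abs_le]; constructor <;> linarith
        · exact (hb t).trans (by gcongr; exact le_max_right _ _)
      rw [e]
      refine (abs_add_le _ _).trans ((add_le_add h1 h2).trans_eq ?_)
      push_cast
      field_simp
      ring
  rw [tendsto_iff_dist_tendsto_zero]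
  refine squeeze_zero (fun _ => dist_nonneg) (fun t => ?_) (?_ : Tendsto
    (fun t : ℕ => |m 0 - c| * r ^ t + 4 / r * (t * r ^ t)) atTop (𝓝 0))
  · rw [Real.dist_eq]; exact hbound t
  · have h1 := (tendsto_pow_atTop_nhds_zero_of_lt_one hr0.le hr1).const_mul |m 0 - c|
    have h2 := (tendsto_self_mul_const_pow_of_lt_one hr0.le hr1).const_mul (4 / r)
    simpa using h1.add h2

include hX in
lemma tendsto_integral_fedAvg_exampleLoss {α : ℝ} (x₀ : ℝ) {K : ℕ} (hα0 : 0 < α) (hα2 : α < 2)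
    (hK : 1 ≤ K) :
    Tendsto (fun t : ℕ => ∫ ω, fedAvg exampleLoss α K x₀ (fun s => X s ω) t ∂μ) atTop
      (𝓝 (21 / 10)) := by
  refine tendsto_of_contraction (ρ := (1 - α) ^ K) ?_ (abs_integral_center_sub_le hX)
    (integral_fedAvg_succ hX fun S t => ?_)
  · rw [abs_pow]
    exact pow_lt_one₀ (abs_nonneg _) (by rw [abs_lt]; constructor <;> linarith) (by omega)
  · rw [fedAvg_single_succ]
    exact localSteps_eq_of_gradient fun k _ => by rw [gradient_exampleLoss]; ring

/-! ### Truncated quadratic losses -/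

/-- Projection of the real line onto `[1, 3]`. -/
noncomputable def clampIcc (x : ℝ) : ℝ := max 1 (min x 3)

lemma continuous_clampIcc : Continuous clampIcc := by unfold clampIcc; fun_prop

lemma clampIcc_of_mem {x : ℝ} (hx : x ∈ Set.Icc (1 : ℝ) 3) : clampIcc x = x := by
  rw [clampIcc, min_eq_left hx.2, max_eq_right hx.1]

lemma clampIcc_mem (x : ℝ) : clampIcc x ∈ Set.Icc (1 : ℝ) 3 :=
  ⟨le_max_left _ _, max_le (by norm_num) (min_le_right _ _)⟩

lemma monotone_clampIcc : Monotone clampIcc := fun _ _ h =>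
  max_le_max le_rfl (min_le_min h le_rfl)

lemma abs_clampIcc_sub_le (x y : ℝ) : |clampIcc x - clampIcc y| ≤ |x - y| := by
  rw [clampIcc, clampIcc]
  refine (abs_max_sub_max_le_max _ _ _ _).trans (max_le (by simp) ?_)
  exact (abs_min_sub_min_le_max _ _ _ _).trans (max_le le_rfl (by simp))

/-- The example losses, continued affinely outside `[1, 3]`. -/
noncomputable def truncatedLoss (i : Fin 3) (x : ℝ) : ℝ :=
  (∫ z in (1 : ℝ)..x, clampIcc z) + (1 / 2 + 1 / 2 * exampleCenter i ^ 2 - exampleCenter i * x)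

lemma hasGradientAt_truncatedLoss (i : Fin 3) (x : ℝ) :
    HasGradientAt (truncatedLoss i) (clampIcc x - exampleCenter i) x := by
  have h1 := (continuous_clampIcc.integral_hasStrictDerivAt 1 x).hasDerivAt
  have h2 := ((hasDerivAt_id x).const_mul (exampleCenter i)).const_sub
    (1 / 2 + 1 / 2 * exampleCenter i ^ 2)
  refine HasDerivAt.hasGradientAt' ?_
  exact (h1.add h2).congr_deriv (by rw [mul_one, sub_eq_add_neg])

lemma gradient_truncatedLoss (i : Fin 3) (x : ℝ) :
    gradient (truncatedLoss i) x = clampIcc x - exampleCenter i :=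
  (hasGradientAt_truncatedLoss i x).gradient

lemma gradient_globalObj_truncatedLoss (x : ℝ) :
    gradient (globalObj truncatedLoss) x = clampIcc x - 2 := by
  rw [(hasGradientAt_globalObj fun i => hasGradientAt_truncatedLoss i x).gradient,
    Fin.sum_univ_three]
  norm_num [exampleCenter]
  ring

lemma gradient_globalObj_exampleLoss (x : ℝ) : gradient (globalObj exampleLoss) x = x - 2 := by
  rw [(hasGradientAt_globalObj fun i => (hasDerivAt_exampleLoss i x).hasGradientAt').gradient,
    Fin.sum_univ_three]
  norm_num [exampleCenter]
  ring

/-- The summand `1 / 2` in `truncatedLoss` compensates the lower limit `1` of the integral. -/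
lemma truncatedLoss_of_mem (i : Fin 3) {x : ℝ} (hx : x ∈ Set.Icc (1 : ℝ) 3) :
    truncatedLoss i x = exampleLoss i x := by
  have h : ∫ z in (1 : ℝ)..x, clampIcc z = ∫ z in (1 : ℝ)..x, z := by
    refine intervalIntegral.integral_congr fun z hz => ?_
    rw [Set.uIcc_of_le hx.1] at hz
    exact clampIcc_of_mem ⟨hz.1, hz.2.trans hx.2⟩
  rw [truncatedLoss, h, integral_id, exampleLoss, exampleCenter]
  ring

lemma globalObj_truncatedLoss (x : ℝ) :
    globalObj truncatedLoss x = (∫ z in (1 : ℝ)..x, clampIcc z) + (17 / 6 - 2 * x) := by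
  simp only [globalObj, truncatedLoss, Fin.sum_univ_three]
  norm_num [exampleCenter]
  ring

lemma two_mul_sub_le_integral_clampIcc (x : ℝ) : 2 * (x - 2) ≤ ∫ z in (2 : ℝ)..x, clampIcc z := by
  have hc2 : clampIcc 2 = 2 := clampIcc_of_mem (by norm_num)
  rcases le_total 2 x with h | h
  · have := intervalIntegral.integral_mono_on (μ := volume) (f := fun _ => (2 : ℝ)) h intervalIntegrable_const
      (continuous_clampIcc.intervalIntegrable 2 x) fun z hz => by
        rw [← hc2]; exact monotone_clampIcc hz.1
    simp at this
    linarith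
  · have := intervalIntegral.integral_mono_on (μ := volume) (g := fun _ => (2 : ℝ)) h
      (continuous_clampIcc.intervalIntegrable x 2) intervalIntegrable_const fun z hz => by
        rw [← hc2]; exact monotone_clampIcc hz.2
    simp at this
    rw [intervalIntegral.integral_symm]
    linarith

/-- The derivative `clampIcc x - 2` is monotone with zero at `2`, so `2` is a minimizer, and on `[1,
3]` the excess over the minimum is `(x₀ - 2) ^ 2 / 2`. -/
lemma globalObj_truncatedLoss_sub_le {x₀ : ℝ} (hx₀ : x₀ ∈ Set.Icc (1 : ℝ) 3) (x : ℝ) :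
    globalObj truncatedLoss x₀ - globalObj truncatedLoss x ≤ 1 := by
  have h1 := two_mul_sub_le_integral_clampIcc x
  have h2 := intervalIntegral.integral_add_adjacent_intervals
    (continuous_clampIcc.intervalIntegrable (μ := volume) 1 2)
    (continuous_clampIcc.intervalIntegrable 2 x)
  have h3 : ∀ y ∈ Set.Icc (1 : ℝ) 3, ∫ z in (1 : ℝ)..y, clampIcc z = (y ^ 2 - 1) / 2 := by
    intro y hy
    have : ∫ z in (1 : ℝ)..y, clampIcc z = ∫ z in (1 : ℝ)..y, z := by
      refine intervalIntegral.integral_congr fun z hz => ?_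
      rw [Set.uIcc_of_le hy.1] at hz
      exact clampIcc_of_mem ⟨hz.1, hz.2.trans hy.2⟩
    rw [this, integral_id]
    ring
  rw [globalObj_truncatedLoss, globalObj_truncatedLoss, ← h2, h3 x₀ hx₀, h3 2 (by norm_num)]
  nlinarith [hx₀.1, hx₀.2]

lemma exampleCenter_mem (i : Fin 3) : exampleCenter i ∈ Set.Icc (1 : ℝ) 3 := by
  fin_cases i <;> norm_num [exampleCenter]

lemma isRegular_truncatedLoss : IsRegular truncatedLoss 1 1 1 where
  differentiable i x := (hasGradientAt_truncatedLoss i x).hasFDerivAt.differentiableAt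
  smooth i x y := by
    rw [gradient_truncatedLoss, gradient_truncatedLoss, sub_sub_sub_cancel_right, one_mul]
    exact abs_clampIcc_sub_le x y
  hetero i x := by
    rw [gradient_truncatedLoss, gradient_globalObj_truncatedLoss, sub_sub_sub_cancel_left,
      Real.norm_eq_abs, sq_abs]
    have := exampleCenter_mem i
    nlinarith [this.1, this.2]
  gradBound x := by
    rw [gradient_globalObj_truncatedLoss, Real.norm_eq_abs, abs_le]
    have := clampIcc_mem x
    constructor <;> linarith [this.1, this.2]

/-- On `[1, 3]` FedAvg with the truncated losses contracts towards the center of the sampled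
client. -/
lemma fedAvg_truncatedLoss {α x₀ : ℝ} (hα0 : 0 ≤ α) (hα1 : α ≤ 1) (hx₀ : x₀ ∈ Set.Icc (1 : ℝ) 3)
    (K : ℕ) (S : ℕ → Batch 3 1) (t : ℕ) :
    fedAvg truncatedLoss α K x₀ S t ∈ Set.Icc (1 : ℝ) 3 ∧
      fedAvg truncatedLoss α K x₀ S (t + 1) = exampleCenter (S t 0) +
        (1 - α) ^ K * (fedAvg truncatedLoss α K x₀ S t - exampleCenter (S t 0)) := by
  -- For `α ≤ 1` every local iterate is a convex combination of its start and the center, so the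
  -- truncation is never felt.
  have hmem : ∀ (i : Fin 3) (k : ℕ), ∀ x ∈ Set.Icc (1 : ℝ) 3,
      exampleCenter i + (1 - α) ^ k * (x - exampleCenter i) ∈ Set.Icc (1 : ℝ) 3 := by
    intro i k x hx
    have h0 : 0 ≤ (1 - α) ^ k := pow_nonneg (by linarith) k
    have h1 : (1 - α) ^ k ≤ 1 := pow_le_one₀ (by linarith) (by linarith)
    have h2 := exampleCenter_mem i
    have := (convex_Icc (1 : ℝ) 3) hx h2 h0 (sub_nonneg.2 h1) (by ring)
    convert this using 1
    simp only [smul_eq_mul]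
    ring
  have hstep : ∀ t, fedAvg truncatedLoss α K x₀ S t ∈ Set.Icc (1 : ℝ) 3 →
      fedAvg truncatedLoss α K x₀ S (t + 1) = exampleCenter (S t 0) +
        (1 - α) ^ K * (fedAvg truncatedLoss α K x₀ S t - exampleCenter (S t 0)) := by
    intro t ht
    rw [fedAvg_single_succ]
    refine localSteps_eq_of_gradient fun k _ => ?_
    rw [gradient_truncatedLoss, clampIcc_of_mem (hmem _ k _ ht)]
    ring
  have hall : ∀ t, fedAvg truncatedLoss α K x₀ S t ∈ Set.Icc (1 : ℝ) 3 := fun t => by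
    induction t with
    | zero => exact hx₀
    | succ t ih => rw [hstep t ih]; exact hmem _ K _ ih
  exact ⟨hall t, hstep t (hall t)⟩

include hX in
/-- Lower bound for the sum of the expected iterates. -/
lemma sum_integral_fedAvg_ge {α x₀ : ℝ} (hα0 : 0 < α) (hα1 : α ≤ 1)
    (hx₀ : x₀ ∈ Set.Icc (1 : ℝ) 3) {K : ℕ} (hK : 1 ≤ K) (T : ℕ) :
    21 / 10 * T - 6 - 2 / α ≤
      ∑ t ∈ Finset.range T, ∫ ω, fedAvg truncatedLoss α K x₀ (fun s => X s ω) t ∂μ := by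
  set m : ℕ → ℝ := fun t => ∫ ω, fedAvg truncatedLoss α K x₀ (fun s => X s ω) t ∂μ with hm
  set b : ℕ → ℝ := fun t => ∫ ω, exampleCenter (X t ω 0) ∂μ with hb
  set ρ := (1 - α) ^ K with hρ
  have hρα : α ≤ 1 - ρ := by
    have : ρ ≤ 1 - α := pow_le_of_le_one (by linarith) (by linarith) (by omega)
    linarith
  have hrec : ∀ t, m (t + 1) = ρ * m t + (1 - ρ) * b t := integral_fedAvg_succ hX fun S t =>
    (fedAvg_truncatedLoss hα0.le hα1 hx₀ K S t).2
  have hmb : ∀ t, m t ∈ Set.Icc (1 : ℝ) 3 := fun t => by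
    have hi : Integrable (fun ω => fedAvg truncatedLoss α K x₀ (fun s => X s ω) t) μ :=
      integrable_fedAvg (φ := fun x => x) x₀ hX.measurable t
    have h1 := integral_mono (integrable_const 1) hi fun ω =>
      (fedAvg_truncatedLoss hα0.le hα1 hx₀ K (fun s => X s ω) t).1.1
    have h3 := integral_mono hi (integrable_const 3) fun ω =>
      (fedAvg_truncatedLoss hα0.le hα1 hx₀ K (fun s => X s ω) t).1.2
    rw [integral_const, probReal_univ, one_smul] at h1 h3
    exact ⟨h1, h3⟩
  -- The recursion telescopes. Since `m` stays in `[1, 3]` and `1 - ρ ≥ α`, the summed means lag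
  -- behind the summed centers by at most `2 / α`.
  have htel : m T - m 0 = (1 - ρ) * (∑ t ∈ Finset.range T, b t - ∑ t ∈ Finset.range T, m t) := by
    rw [← Finset.sum_range_sub, ← Finset.sum_sub_distrib, Finset.mul_sum]
    exact Finset.sum_congr rfl fun t _ => by rw [hrec]; ring
  have hbsum : 21 / 10 * T - 6 ≤ ∑ t ∈ Finset.range T, b t := by
    have h1 : ∀ t ∈ Finset.range T, 21 / 10 - 2 * (2 / 3 : ℝ) ^ t ≤ b t := fun t _ => by
      have := neg_le_of_abs_le (abs_integral_center_sub_le hX t)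
      simp only [hb]
      linarith
    have h2 := Finset.sum_le_sum h1
    rw [Finset.sum_sub_distrib, Finset.sum_const, Finset.card_range, nsmul_eq_mul,
      ← Finset.mul_sum, geom_sum_eq (by norm_num)] at h2
    have h3 : (0 : ℝ) ≤ (2 / 3) ^ T := by positivity
    have h4 : ((2 / 3 : ℝ) ^ T - 1) / (2 / 3 - 1) = 3 - 3 * (2 / 3) ^ T := by ring
    rw [h4] at h2
    linarith
  have hdiff : ∑ t ∈ Finset.range T, b t - ∑ t ∈ Finset.range T, m t ≤ 2 / α := by
    rw [le_div_iff₀ hα0]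
    by_contra hlt
    push Not at hlt
    have h1 := (hmb T).2
    have h2 := (hmb 0).1
    have h3 : 0 < ∑ t ∈ Finset.range T, b t - ∑ t ∈ Finset.range T, m t :=
      (pos_iff_pos_of_mul_pos (by linarith)).2 hα0
    nlinarith
  linarith

include hX in
/-- The averaged squared gradient norm stays bounded away from zero. -/
lemma outputSqGrad_truncatedLoss_ge {α x₀ : ℝ} (hα0 : 0 < α) (hα1 : α ≤ 1)
    (hx₀ : x₀ ∈ Set.Icc (1 : ℝ) 3) {K : ℕ} (hK : 1 ≤ K) {T : ℕ} (hT : 2400 ≤ T)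
    (hαT : 2 / α ≤ 1 / 500 * T) {I : Ω → Fin T} (hI : IsUniformIndex μ X I) :
    2 / 225 ≤ outputSqGrad μ truncatedLoss α K x₀ X I := by
  have hout : outputSqGrad μ truncatedLoss α K x₀ X I = 1 / (T : ℝ) * ∑ t ∈ Finset.range T,
      ∫ ω, ‖gradient (globalObj truncatedLoss)
        (fedAvg truncatedLoss α K x₀ (fun s => X s ω) t)‖ ^ 2 ∂μ :=
    integral_uniformIndex hX.measurable hI
      (Φ := fun t S => ‖gradient (globalObj truncatedLoss) (fedAvg truncatedLoss α K x₀ S t)‖ ^ 2)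
      fun t S S' hS => by simp only; rw [fedAvg_congr truncatedLoss α K x₀ hS]
  have hT0 : (0 : ℝ) < T := by exact_mod_cast (by omega : 0 < T)
  have hT' : (2400 : ℝ) ≤ T := by exact_mod_cast hT
  -- Tangent line of `(x - 2) ^ 2` at `x = 2.095`. Evaluated at `2.1 - 6 / 2400 - 1 / 500` it gives
  -- `0.00912`, just above `2 / 225 = (1 / 2) * (2 / 15) ^ 2`.
  have hpt : ∀ t ∈ Finset.range T,
      19 / 100 * (∫ ω, fedAvg truncatedLoss α K x₀ (fun s => X s ω) t ∂μ) - 389025 / 1000000 ≤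
      ∫ ω, ‖gradient (globalObj truncatedLoss)
        (fedAvg truncatedLoss α K x₀ (fun s => X s ω) t)‖ ^ 2 ∂μ := fun t _ => by
    have hi : Integrable (fun ω => fedAvg truncatedLoss α K x₀ (fun s => X s ω) t) μ :=
      integrable_fedAvg (φ := fun x => x) x₀ hX.measurable t
    have hi' : Integrable (fun ω => 19 / 100 * fedAvg truncatedLoss α K x₀ (fun s => X s ω) t -
      389025 / 1000000) μ := (hi.const_mul _).sub (integrable_const _)
    have := integral_mono hi' (integrable_fedAvg (f := truncatedLoss) (α := α) (K := K)
      (φ := fun x => ‖gradient (globalObj truncatedLoss) x‖ ^ 2) x₀ hX.measurable t) fun ω => by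
        simp only
        rw [gradient_globalObj_truncatedLoss, clampIcc_of_mem
          (fedAvg_truncatedLoss hα0.le hα1 hx₀ K (fun s => X s ω) t).1, Real.norm_eq_abs, sq_abs]
        nlinarith [sq_nonneg (fedAvg truncatedLoss α K x₀ (fun s => X s ω) t - 2 - 95 / 1000)]
    rwa [integral_sub (hi.const_mul _) (integrable_const _), integral_const_mul, integral_const,
      probReal_univ, one_smul] at this
  have hsum := Finset.sum_le_sum hpt
  rw [Finset.sum_sub_distrib, ← Finset.mul_sum, Finset.sum_const, Finset.card_range,
    nsmul_eq_mul] at hsum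
  have hm := sum_integral_fedAvg_ge hX hα0 hα1 hx₀ hK T
  rw [hout, one_div, ← div_eq_inv_mul, le_div_iff₀ hT0]
  linarith

end Example

end FedAvgMC

/-! ### Assembly of the four statements -/

open FedAvgMC in
theorem theorem1 :
    -- (1) the stationary distribution exists, is unique, and is the limit of the chain
    (∀ (N M B R : ℕ) [NeZero B] (p : Fin N → ℝ), N = M * B → R + 2 ≤ M → IsAvailability p →
      (∃! ζ : State N B R → ℝ, IsStationary (transMatrix R p) ζ) ∧
      ∀ ζ : State N B R → ℝ, IsStationary (transMatrix R p) ζ →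
        ∀ y y', Tendsto (fun t : ℕ => (transMatrix R p ^ t) y y') atTop (𝓝 (ζ y'))) ∧
    -- (2) the convergence bound
    (∃ Cb : ℝ, 0 < Cb ∧
      ∀ L G D Δ c₁ c₂ : ℝ, 0 < L → 0 < G → 0 < D → 0 ≤ Δ → 0 < c₁ → c₁ ≤ c₂ →
      ∃ C : ℝ, 0 < C ∧
        ∀ (N M B R d K T : ℕ) [NeZero B] (p : Fin N → ℝ) (ζ : State N B R → ℝ)
          (f : Fin N → EuclideanSpace ℝ (Fin d) → ℝ) (x₀ : EuclideanSpace ℝ (Fin d)) (α : ℝ),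
          N = M * B → R + 2 ≤ M → 1 ≤ K → IsAvailability p →
          IsStationary (transMatrix R p) ζ →
          IsRegular f L G D → (∀ x, globalObj f x₀ - globalObj f x ≤ Δ) →
          2 * (mixingTime (transMatrix R p) ζ : ℝ) *
              Real.log (mixingTime (transMatrix R p) ζ : ℝ) < (T : ℝ) →
          StepsizeOrder c₁ c₂ (mixingTime (transMatrix R p) ζ) K T α →
          ∀ (Ω : Type*) [MeasurableSpace Ω] (μ : Measure Ω) [IsProbabilityMeasure μ]
            (X : ℕ → Ω → Batch N B) (I : Ω → Fin T),
            IsParticipation R p μ X → IsUniformIndex μ X I →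
            outputSqGrad μ f α K x₀ X I ≤
              C * ((mixingTime (transMatrix R p) ζ : ℝ) * (1 + Real.log (T : ℝ)) / √(T : ℝ))
                + C / (T : ℝ)
                + Cb * (G ^ 2 + D ^ 2) * biasL1 (clientDist R p ζ) ^ 2) ∧
    -- (3) the bias is unavoidable: quadratic losses, constant stepsize
    (∀ ζ : State 3 1 1 → ℝ, IsStationary (transMatrix 1 exampleAvail) ζ →
      clientDist 1 exampleAvail ζ = ![3 / 10, 3 / 10, 4 / 10] ∧
      (∀ (α x₀ : ℝ) (K : ℕ), 0 < α → α < 2 → 1 ≤ K →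
        ∀ (Ω : Type*) [MeasurableSpace Ω] (μ : Measure Ω) [IsProbabilityMeasure μ]
          (X : ℕ → Ω → Batch 3 1), IsParticipation 1 exampleAvail μ X →
          Tendsto (fun t : ℕ => ∫ ω, fedAvg exampleLoss α K x₀ (fun s => X s ω) t ∂μ) atTop
            (𝓝 (∑ i : Fin 3, clientDist 1 exampleAvail ζ i * ((i : ℕ) + 1 : ℝ)))) ∧
      (∀ x : ℝ, x ≠ ∑ i : Fin 3, clientDist 1 exampleAvail ζ i * ((i : ℕ) + 1 : ℝ) →
        ∑ j : Fin 3, clientDist 1 exampleAvail ζ j * exampleLoss j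
            (∑ i : Fin 3, clientDist 1 exampleAvail ζ i * ((i : ℕ) + 1 : ℝ)) <
          ∑ j : Fin 3, clientDist 1 exampleAvail ζ j * exampleLoss j x) ∧
      |gradient (globalObj exampleLoss)
          (∑ i : Fin 3, clientDist 1 exampleAvail ζ i * ((i : ℕ) + 1 : ℝ))| =
        |∑ i : Fin 3, ((i : ℕ) + 1 : ℝ) * (clientDist 1 exampleAvail ζ i - 1 / 3)| ∧
      |∑ i : Fin 3, ((i : ℕ) + 1 : ℝ) * (clientDist 1 exampleAvail ζ i - 1 / 3)| = 1 / 10) ∧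
    -- (4) the bias is unavoidable under all assumptions and with the stepsizes of (2)
    (∃ (f : Fin 3 → ℝ → ℝ) (L G D Δ : ℝ), 0 < L ∧ 0 < G ∧ 0 < D ∧ 0 ≤ Δ ∧
      IsRegular f L G D ∧
      (∀ i, ∀ x ∈ Set.Icc (1 : ℝ) 3, f i x = exampleLoss i x) ∧
      (∀ x₀ ∈ Set.Icc (1 : ℝ) 3, ∀ x, globalObj f x₀ - globalObj f x ≤ Δ) ∧
      ∀ ζ : State 3 1 1 → ℝ, IsStationary (transMatrix 1 exampleAvail) ζ →
        0 < biasL1 (clientDist 1 exampleAvail ζ) ∧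
        ∀ (K : ℕ) (c₁ c₂ : ℝ), 1 ≤ K → 0 < c₁ → c₁ ≤ c₂ →
          ∃ T₀ : ℕ, ∀ (T : ℕ) (α x₀ : ℝ), T₀ ≤ T → x₀ ∈ Set.Icc (1 : ℝ) 3 →
            StepsizeOrder c₁ c₂ (mixingTime (transMatrix 1 exampleAvail) ζ) K T α →
            ∀ (Ω : Type*) [MeasurableSpace Ω] (μ : Measure Ω) [IsProbabilityMeasure μ]
              (X : ℕ → Ω → Batch 3 1) (I : Ω → Fin T),
              IsParticipation 1 exampleAvail μ X → IsUniformIndex μ X I →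
              (1 / 2) * biasL1 (clientDist 1 exampleAvail ζ) ^ 2 ≤
                outputSqGrad μ f α K x₀ X I) := by
  refine ⟨fun N M B R _ p hN hR hp =>
    ⟨existsUnique_isStationary_transMatrix hR hp hN,
      fun ζ hζ y y' => tendsto_transMatrix_pow hR hp hN hζ y y'⟩, ?_, ?_, ?_⟩
  · refine ⟨1, one_pos, fun L G D Δ c₁ c₂ hL hG hD hΔ hc₁ hc => ?_⟩
    have hc₂ : 0 < c₂ := hc₁.trans_le hc
    refine ⟨16 * (G + D) ^ 2 + 16 * L * (G + D) ^ 2 * c₂ + 2 * Δ / c₁, by positivity, ?_⟩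
    intro N M B R d K T _ p ζ f x₀ α hN hR hK hp hζ hf hΔ' _ hα Ω _ μ _ X I hX hI
    exact outputSqGrad_le hL hG hD hΔ hc₁ hc hN hR hK hp hζ hf hΔ' hα hX hI
  · intro ζ hζ
    rw [sum_clientDist_mul_center hζ]
    have hcd := clientDist_example hζ
    have hbias : |∑ i : Fin 3, ((i : ℕ) + 1 : ℝ) * (clientDist 1 exampleAvail ζ i - 1 / 3)| =
        1 / 10 := by
      rw [hcd, Fin.sum_univ_three]
      norm_num [vecCons_three_two, abs_of_pos]
    refine ⟨hcd, ?_, ?_, ?_, hbias⟩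
    · intro α x₀ K hα0 hα2 hK Ω _ μ _ X hX
      exact tendsto_integral_fedAvg_exampleLoss hX x₀ hα0 hα2 hK
    · intro x hx
      have := sq_pos_of_ne_zero (sub_ne_zero.2 hx)
      rw [hcd, Fin.sum_univ_three, Fin.sum_univ_three]
      norm_num [exampleLoss, vecCons_three_two]
      nlinarith
    · rw [hbias, gradient_globalObj_exampleLoss]
      norm_num [abs_of_pos]
  · refine ⟨truncatedLoss, 1, 1, 1, 1, one_pos, one_pos, one_pos, zero_le_one,
      isRegular_truncatedLoss, fun i x hx => truncatedLoss_of_mem i hx,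
      fun x₀ hx₀ x => globalObj_truncatedLoss_sub_le hx₀ x, fun ζ hζ => ?_⟩
    rw [biasL1_example hζ]
    refine ⟨by norm_num, fun K c₁ c₂ hK hc₁ hc => ?_⟩
    have hτ := (one_le_mixingTime (tendsto_transMatrix_pow (M := 3) (by norm_num)
      exampleAvail_isAvailability (by norm_num) hζ)).1
    set τ := mixingTime (transMatrix 1 exampleAvail) ζ
    have hτ1 : (1 : ℝ) ≤ τ := by exact_mod_cast hτ
    have hK1 : (1 : ℝ) ≤ K := by exact_mod_cast hK
    have hτK : (1 : ℝ) ≤ τ * K := one_le_mul_of_one_le_of_one_le hτ1 hK1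
    have hc₂ : 0 < c₂ := hc₁.trans_le hc
    -- The first summand forces `α ≤ 1`, the second absorbs the initial error of the centers, and
    -- the third gives `1000 ≤ α * T`, which bounds `2 / α` by `T / 500`.
    refine ⟨⌈c₂ ^ 2⌉₊ + 2400 + ⌈(1000 * (τ * K) / c₁) ^ 2⌉₊, ?_⟩
    intro T α x₀ hT hx₀ hα Ω _ μ _ X I hX hI
    have hT1 : c₂ ^ 2 ≤ T := (Nat.le_ceil _).trans (Nat.cast_le.2 (by omega))
    have hT2 : (1000 * (τ * K) / c₁) ^ 2 ≤ T :=
      (Nat.le_ceil _).trans (Nat.cast_le.2 (by omega))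
    have hT0 : (0 : ℝ) < T := by exact_mod_cast (by omega : 0 < T)
    have hsq : 0 < √(T : ℝ) := Real.sqrt_pos.2 hT0
    have hsqT : √(T : ℝ) * √(T : ℝ) = T := Real.mul_self_sqrt hT0.le
    have hs1 : c₂ ≤ √(T : ℝ) := Real.le_sqrt_of_sq_le hT1
    have hs2 : 1000 * (τ * K) / c₁ ≤ √(T : ℝ) := Real.le_sqrt_of_sq_le hT2
    have hα0 : 0 < α := lt_of_lt_of_le (by positivity) hα.1
    have hα1 : α ≤ 1 := by
      refine hα.2.trans ((div_le_one (by positivity)).2 ?_)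
      nlinarith
    have hαT : 2 / α ≤ 1 / 500 * T := by
      rw [div_le_iff₀ hα0]
      have h1 : c₁ ≤ α * (τ * K * √(T : ℝ)) := (div_le_iff₀ (by positivity)).1 hα.1
      rw [div_le_iff₀ hc₁] at hs2
      have h2 : √(T : ℝ) * c₁ ≤ √(T : ℝ) * (α * (τ * K * √(T : ℝ))) := by gcongr
      have h3 : 1000 * (τ * K) ≤ (τ * K) * (α * T) := by
        calc 1000 * (τ * K) ≤ √(T : ℝ) * c₁ := hs2
          _ ≤ √(T : ℝ) * (α * (τ * K * √(T : ℝ))) := h2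
          _ = (τ * K) * (α * (√(T : ℝ) * √(T : ℝ))) := by ring
          _ = _ := by rw [hsqT]
      have h4 : 1000 ≤ α * T := by
        rw [mul_comm] at h3
        exact le_of_mul_le_mul_left h3 (by linarith)
      linarith
    have := outputSqGrad_truncatedLoss_ge hX hα0 hα1 hx₀ hK (by omega) hαT hI
    norm_num at this ⊢
    exact this
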